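/- For $\sigma\ge 0$ let $H^\sigma(\mathbb{R}^d)$ be the $L^2$-based Sobolev space with norm $\|u\|_{H^\sigma}=\|(I-\Delta)^{\sigma/2}u\|_{L^2}$. For a vector field $v=(v_1,\dots,v_d)$ on $\mathbb{R}^d$ write $\nabla v=(\partial_i v_j)_{i,j}$, $\operatorname{div} v=\sum_i\partial_i v_i$ and $\operatorname{curl} v=(\partial_i v_j-\partial_j v_i)_{i<j}$ (so $\operatorname{curl} v=0$ if $d=1$), derivatives being taken in the sense of distributions; the $H^\sigma$ norm of a family is the square root of the sum of the squares of the norms of its entries. All functions and vector fields are real valued. (1) Let $d\ge 3$ and let $s>d/2$ be an integer. There exists a function $\mathcal{C}:[0,\infty)^2\to\mathbb{R}$, nondecreasing in each variable and depending only on $d$ and $s$, such that for all $\varphi\in H^{s+1}(\mathbb{R}^d)$ and all vector fields $v\in H^{s+1}(\mathbb{R}^d)$ one has $\nabla\varphi\in L^\infty$, $e^{\varphi}v\in H^{s+1}(\mathbb{R}^d)$ and $$\|\nabla v\|_{H^s}\le C\,\|\operatorname{div}(e^{\varphi}v)\|_{H^s}+C\,\|\operatorname{curl} v\|_{H^s},\qquad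 C:=(1+\|\varphi\|_{H^{s+1}})\,\mathcal{C}\bigl(\|\varphi\|_{H^s},\|\nabla\varphi\|_{L^\infty}\bigr).$$ (2) Let $d=1$ or $d\ge 3$ and let $s>d/2$ be an integer. There exists a nondecreasing function $\mathcal{C}:[0,\infty)\to\mathbb{R}$, depending only on $d$ and $s$, such that for all $\varphi\in H^{s+1}(\mathbb{R}^d)$ and all vector fields $v\in H^{s+1}(\mathbb{R}^d)$ one has $e^{\varphi}v\in H^{s+1}(\mathbb{R}^d)$ and $$\|\nabla v\|_{H^s}\le \mathcal{C}\bigl(\|\varphi\|_{H^{s+1}}\bigr)\bigl(\|\operatorname{div} v\|_{H^s}+\|\operatorname{curl}(e^{\varphi}v)\|_{H^s}\bigr).$$ -/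

import Mathlib

open MeasureTheory TemperedDistribution
open scoped SchwartzMap LineDeriv ENNReal

noncomputable section

namespace WeightedFriedrichs

/-- The Euclidean space `ℝ^d`. -/
abbrev E (d : ℕ) : Type := EuclideanSpace ℝ (Fin d)

/-- The `i`-th vector of the canonical basis of `ℝ^d`. -/
def e {d : ℕ} (i : Fin d) : E d := EuclideanSpace.single i (1 : ℝ)

open Classical in
/-- The tempered distribution `g ↦ ∫ f g` given by a square integrable function `f` (and `0` for a
function which is not square integrable). -/
def toDist {d : ℕ} (f : E d → ℂ) : 𝓢'(E d, ℂ) :=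
  if h : MemLp f 2 volume then ((h.toLp f : Lp ℂ 2 (volume : Measure (E d))) : 𝓢'(E d, ℂ)) else 0

/-- The symbol `(1 + |2πξ|²)^{σ/2}` of `(I - Δ)^{σ/2}`; with Mathlib's convention
`𝓕 f (ξ) = ∫ e^{-2πi⟨x,ξ⟩} f(x) dx`, the symbol of `-Δ` is `|2πξ|²`. -/
def besselSymbol (d : ℕ) (σ : ℝ) (ξ : E d) : ℂ :=
  (((1 + ‖(2 * Real.pi) • ξ‖ ^ 2) ^ (σ / 2) : ℝ) : ℂ)

/-- The operator `(I - Δ)^{σ/2}` on tempered distributions. -/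
def bessel {d : ℕ} (σ : ℝ) : 𝓢'(E d, ℂ) →L[ℂ] 𝓢'(E d, ℂ) :=
  fourierMultiplierCLM ℂ (besselSymbol d σ)

open Classical in
/-- The norm `‖u‖_{H^σ} = ‖(I - Δ)^{σ/2} u‖_{L²}` (and `0` if `u ∉ H^σ`). -/
def sobolevNorm {d : ℕ} (σ : ℝ) (u : 𝓢'(E d, ℂ)) : ℝ :=
  if h : ∃ f : Lp ℂ 2 (volume : Measure (E d)), bessel σ u = (f : 𝓢'(E d, ℂ)) then ‖h.choose‖ else 0

theorem sobolevNorm_eq {d : ℕ} {σ : ℝ} {u : 𝓢'(E d, ℂ)} {f : Lp ℂ 2 (volume : Measure (E d))}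
    (hf : bessel σ u = (f : 𝓢'(E d, ℂ))) : sobolevNorm σ u = ‖f‖ := by
  have h : ∃ f : Lp ℂ 2 (volume : Measure (E d)), bessel σ u = (f : 𝓢'(E d, ℂ)) := ⟨f, hf⟩
  have hc : h.choose = f := by
    have h1 : Lp.toTemperedDistributionCLM ℂ volume 2 h.choose
        = Lp.toTemperedDistributionCLM ℂ volume 2 f := by
      rw [Lp.toTemperedDistributionCLM_apply, Lp.toTemperedDistributionCLM_apply,
        ← h.choose_spec, hf]
    exact LinearMap.ker_eq_bot.mp Lp.ker_toTemperedDistributionCLM_eq_bot h1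
  rw [sobolevNorm, dif_pos h, hc]

theorem besselSymbol_hasTemperateGrowth (d : ℕ) (σ : ℝ) :
    (besselSymbol d σ).HasTemperateGrowth := by
  have h1 := Function.hasTemperateGrowth_one_add_norm_sq_rpow (E d) (σ / 2)
  have h2 : (fun ξ : E d ↦ (2 * Real.pi) • ξ).HasTemperateGrowth := by fun_prop
  have h3 := h1.comp h2
  unfold besselSymbol
  fun_prop

theorem ratio_rpow_le {t p : ℝ} (ht : 0 ≤ t) :
    (1 + (2 * Real.pi) ^ 2 * t) ^ p * (1 + t) ^ (-p) ≤ ((2 * Real.pi) ^ 2) ^ |p| ∧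
    (1 + (2 * Real.pi) ^ 2 * t) ^ (-p) * (1 + t) ^ p ≤ ((2 * Real.pi) ^ 2) ^ |p| := by
  have hc : (1 : ℝ) ≤ (2 * Real.pi) ^ 2 := by nlinarith [Real.pi_gt_three]
  generalize (2 * Real.pi) ^ 2 = c at hc
  have h0 : (0 : ℝ) < 1 + t := by positivity
  have h1 : (0 : ℝ) < 1 + c * t := by positivity
  have hr : 1 ≤ (1 + c * t) / (1 + t) := by rw [le_div_iff₀ h0]; nlinarith
  have hr' : (1 + c * t) / (1 + t) ≤ c := by rw [div_le_iff₀ h0]; nlinarith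
  have key : ∀ q : ℝ, |q| = |p| → (1 + c * t) ^ q * (1 + t) ^ (-q) ≤ c ^ |p| := by
    intro q hq
    rw [Real.rpow_neg h0.le, ← div_eq_mul_inv, ← Real.div_rpow h1.le h0.le, ← hq]
    calc ((1 + c * t) / (1 + t)) ^ q ≤ ((1 + c * t) / (1 + t)) ^ |q| :=
          Real.rpow_le_rpow_of_exponent_le hr (le_abs_self q)
      _ ≤ c ^ |q| := Real.rpow_le_rpow (by linarith) hr' (abs_nonneg q)
  exact ⟨key p rfl, by simpa using key (-p) (abs_neg p)⟩

/-- The distributions for which `sobolevNorm σ` takes its genuine value are exactly the elements of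
Mathlib's Sobolev space of order `σ`. -/
theorem memSobolev_iff_bessel {d : ℕ} (σ : ℝ) (u : 𝓢'(E d, ℂ)) :
    MemSobolev σ 2 u ↔ ∃ f : Lp ℂ 2 (volume : Measure (E d)), bessel σ u = (f : 𝓢'(E d, ℂ)) := by
  have hB := besselSymbol_hasTemperateGrowth d
  have hM : ∀ τ : ℝ, (fun x : E d ↦ (((1 + ‖x‖ ^ 2) ^ (τ / 2) : ℝ) : ℂ)).HasTemperateGrowth :=
    fun τ ↦ by fun_prop
  have hnorm : ∀ ξ : E d, ‖(2 * Real.pi) • ξ‖ ^ 2 = (2 * Real.pi) ^ 2 * ‖ξ‖ ^ 2 := by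
    intro ξ
    rw [norm_smul, mul_pow, Real.norm_eq_abs, sq_abs]
  constructor
  · intro h
    rw [← memSobolev_zero_iff]
    have h0 : MemSobolev 0 2 (besselPotential (E d) ℂ σ u) := by
      rw [memSobolev_besselPotential_iff]; simpa using h
    have h1 := h0.fourierMultiplierCLM_of_bounded (g := besselSymbol d σ *
      fun x ↦ (((1 + ‖x‖ ^ 2) ^ (-σ / 2) : ℝ) : ℂ)) ((hB σ).mul (hM (-σ)))
      ⟨((2 * Real.pi) ^ 2) ^ |σ / 2|, fun x ↦ ?_⟩
    · rw [besselPotential, fourierMultiplierCLM_fourierMultiplierCLM_apply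
        (hM σ) ((hB σ).mul (hM (-σ)))] at h1
      have hs : (fun x : E d ↦ (((1 + ‖x‖ ^ 2) ^ (σ / 2) : ℝ) : ℂ)) * (besselSymbol d σ *
          fun x ↦ (((1 + ‖x‖ ^ 2) ^ (-σ / 2) : ℝ) : ℂ)) = besselSymbol d σ := by
        ext x
        simp only [Pi.mul_apply]
        rw [mul_left_comm, ← Complex.ofReal_mul, ← Real.rpow_add (by positivity)]
        ring_nf
        simp
      rwa [hs] at h1
    · have := (ratio_rpow_le (t := ‖x‖ ^ 2) (p := σ / 2) (by positivity)).1
      simp only [Pi.mul_apply, besselSymbol, hnorm]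
      rw [← Complex.ofReal_mul, Complex.norm_real, Real.norm_eq_abs, abs_of_nonneg (by positivity)]
      rwa [neg_div]
  · intro h
    rw [← memSobolev_zero_iff] at h
    have h1 := h.fourierMultiplierCLM_of_bounded (g := besselSymbol d (-σ) *
      fun x ↦ (((1 + ‖x‖ ^ 2) ^ (σ / 2) : ℝ) : ℂ)) ((hB (-σ)).mul (hM σ))
      ⟨((2 * Real.pi) ^ 2) ^ |σ / 2|, fun x ↦ ?_⟩
    · rw [bessel, fourierMultiplierCLM_fourierMultiplierCLM_apply
        (hB σ) ((hB (-σ)).mul (hM σ))] at h1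
      have hs : besselSymbol d σ * (besselSymbol d (-σ) *
          fun x ↦ (((1 + ‖x‖ ^ 2) ^ (σ / 2) : ℝ) : ℂ)) =
          fun x : E d ↦ (((1 + ‖x‖ ^ 2) ^ (σ / 2) : ℝ) : ℂ) := by
        ext x
        simp only [Pi.mul_apply, besselSymbol]
        rw [← mul_assoc, ← Complex.ofReal_mul, ← Real.rpow_add (by positivity)]
        ring_nf
        simp
      rw [hs] at h1
      have h2 : MemSobolev 0 2 (besselPotential (E d) ℂ σ u) := h1
      rw [memSobolev_besselPotential_iff] at h2
      simpa using h2
    · have := (ratio_rpow_le (t := ‖x‖ ^ 2) (p := σ / 2) (by positivity)).2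
      simp only [Pi.mul_apply, besselSymbol, hnorm]
      rw [← Complex.ofReal_mul, Complex.norm_real, Real.norm_eq_abs, abs_of_nonneg (by positivity)]
      rwa [neg_div]

/-- A real function belongs to `H^σ(ℝ^d)` (`σ ≥ 0`). -/
def MemH {d : ℕ} (σ : ℝ) (f : E d → ℝ) : Prop :=
  MemLp f 2 volume ∧ MemSobolev σ 2 (toDist fun x ↦ (f x : ℂ))

/-- A real vector field belongs to `H^σ(ℝ^d)` (`σ ≥ 0`). -/
def VecMemH {d : ℕ} (σ : ℝ) (v : E d → E d) : Prop :=
  ∀ i, MemH σ fun x ↦ v x i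

/-- The distributional derivative `∂_i v_j` of a square integrable vector field. -/
def pd {d : ℕ} (v : E d → E d) (i j : Fin d) : 𝓢'(E d, ℂ) :=
  ∂_{e i} (toDist fun x ↦ (v x j : ℂ))

/-- `‖f‖_{H^σ}` for a real function. -/
def normH {d : ℕ} (σ : ℝ) (f : E d → ℝ) : ℝ :=
  sobolevNorm σ (toDist fun x ↦ (f x : ℂ))

/-- `‖∇v‖_{H^σ}`, where `∇v = (∂_i v_j)_{i,j}`. -/
def normGrad {d : ℕ} (σ : ℝ) (v : E d → E d) : ℝ :=
  Real.sqrt (∑ i, ∑ j, sobolevNorm σ (pd v i j) ^ 2)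

/-- `‖div v‖_{H^σ}`. -/
def normDiv {d : ℕ} (σ : ℝ) (v : E d → E d) : ℝ :=
  sobolevNorm σ (∑ i, pd v i i)

/-- `‖curl v‖_{H^σ}`, where `curl v = (∂_i v_j - ∂_j v_i)_{i<j}`. -/
def normCurl {d : ℕ} (σ : ℝ) (v : E d → E d) : ℝ :=
  Real.sqrt (∑ j, ∑ i ∈ Finset.univ.filter (· < j), sobolevNorm σ (pd v i j - pd v j i) ^ 2)

/-- `G` is the distributional gradient of the real function `φ`. -/
def IsGradient {d : ℕ} (φ : E d → ℝ) (G : E d → EuclideanSpace ℂ (Fin d)) : Prop :=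
  MemLp G 2 volume ∧ ∀ i, toDist (fun x ↦ G x i) = ∂_{e i} (toDist fun x ↦ (φ x : ℂ))

/-- `‖∇φ‖_{L^∞}`, the essential supremum of `|∇φ|`. The gradient is unique up to null sets; the
value is `∞` if there is no square integrable gradient. -/
def gradSup {d : ℕ} (φ : E d → ℝ) : ℝ≥0∞ :=
  ⨅ (G : E d → EuclideanSpace ℂ (Fin d)) (_ : IsGradient φ G), eLpNorm G ∞ volume

/-- The vector field `e^φ v`. -/
def weighted {d : ℕ} (φ : E d → ℝ) (v : E d → E d) : E d → E d :=
  fun x ↦ Real.exp (φ x) • v x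

end WeightedFriedrichs

end

open scoped FourierTransform

noncomputable section

namespace WeightedFriedrichs

/-! Sobolev bounds are weighted `L²` bounds on Fourier transforms, and the whole argument is run
there. Put `g = e^φ v`, `α = e^φ - 1`, and let `δ` bound `div g` and `curl v` in `H^s`. Since `Δ v_j
= ∂_j div v + ∑ ∂_i (∂_i v_j - ∂_j v_i)`, the gradient of `v` is controlled by `div v` and `curl v`
(`BW.hw_of_div_curl`), so what has to be bounded is `div v`.

Low order (`exists_lowOrder`): let `u` be minus the gradient part of `α v` in the Helmholtz
decomposition. As `g = v + α v`, the field `v - u` has divergence `div g` and the curl of `v`; its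
homogeneous norm is `O(δ)`, and for `d ≥ 3` so is its sup norm, because `|ξ|⁻²` is integrable at the
origin. Moreover `u + α v` is divergence free and `u` is a gradient, so `∫ (1 + α)|u|² = -∫ α (v -
u)·u`. Since `1 + α = e^φ` is bounded below, `‖u‖_{L²} = O(δ)`, without any smallness of `φ`.

High order (`exists_weighted_div_curl`): `v = e^{-φ} g` gives `div v = e^{-φ} div g - ∇φ·v`
(`div_eq_of_weighted`). In `H^{s-1}` the last product is split along `v = (v - u) + u`.
Interpolating `u` between `L²` and its top order norm, which is bounded by `div v` and `δ`, produces
a small multiple of the norm of `div v`, which is absorbed. The identity is then used once more in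
`H^s`; there `‖φ‖_{H^{s+1}}` enters once and linearly, thanks to the tame bounds of
`exists_exp_sub_one`.

The second estimate for `d ≥ 3` is the first one for `-φ` and `e^φ v`, followed by the product rule;
for `d = 1` the gradient is the divergence. -/

variable {d : ℕ}

/-! ### Fourier pairs in `L²` -/

/-- `F` represents the Fourier transform of the square integrable function `f`. -/
structure IsFT (f F : E d → ℂ) : Prop where
  memLp : MemLp f 2 volume
  memLp' : MemLp F 2 volume
  eq : 𝓕 (memLp.toLp f) = memLp'.toLp F

theorem ae_eq_of_schwartz {f g : E d → ℂ} (hf : LocallyIntegrable f) (hg : LocallyIntegrable g)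
    (h : ∀ ψ : 𝓢(E d, ℂ), ∫ x, ψ x * f x = ∫ x, ψ x * g x) : f =ᵐ[volume] g := by
  refine ae_eq_of_integral_contDiff_smul_eq hf hg fun ψ hψ hc ↦ ?_
  have hc' : HasCompactSupport (Complex.ofRealCLM ∘ ψ) := hc.comp_left rfl
  have hψ' : ContDiff ℝ (⊤ : ℕ∞) (Complex.ofRealCLM ∘ ψ) := by fun_prop
  simpa using h (hc'.toSchwartzMap hψ')

theorem toDist_of_memLp {f : E d → ℂ} (hf : MemLp f 2 volume) :
    toDist f = (hf.toLp f : 𝓢'(E d, ℂ)) := by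
  rw [toDist, dif_pos hf]

theorem toLp_schwartz {f : E d → ℂ} (hf : MemLp f 2 volume) (ψ : 𝓢(E d, ℂ)) :
    (hf.toLp f : 𝓢'(E d, ℂ)) ψ = ∫ x, ψ x * f x := by
  rw [Lp.toTemperedDistribution_apply]
  refine integral_congr_ae ?_
  filter_upwards [hf.coeFn_toLp] with x hx
  rw [hx, smul_eq_mul]

namespace IsFT

variable {f g F G : E d → ℂ}

theorem exists_fourier (hf : MemLp f 2 volume) : ∃ F, IsFT f F := by
  refine ⟨(𝓕 (hf.toLp f) : Lp ℂ 2 (volume : Measure (E d))), hf, Lp.memLp _, ?_⟩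
  rw [Lp.toLp_coeFn]

theorem exists_fourierInv (hF : MemLp F 2 volume) : ∃ f, IsFT f F := by
  refine ⟨(𝓕⁻ (hF.toLp F) : Lp ℂ 2 (volume : Measure (E d))), Lp.memLp _, hF, ?_⟩
  rw [Lp.toLp_coeFn, FourierTransform.fourier_fourierInv_eq]

theorem congr (h : IsFT f F) (hf : f =ᵐ[volume] g) (hF : F =ᵐ[volume] G) : IsFT g G := by
  refine ⟨h.memLp.ae_eq hf, h.memLp'.ae_eq hF, ?_⟩
  rw [MemLp.toLp_congr (h.memLp.ae_eq hf) h.memLp hf.symm,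
    MemLp.toLp_congr (h.memLp'.ae_eq hF) h.memLp' hF.symm, h.eq]

theorem unique (h : IsFT f F) (h' : IsFT f G) : F =ᵐ[volume] G := by
  have := h.eq.symm.trans h'.eq
  rwa [MemLp.toLp_eq_toLp_iff] at this

theorem add (h : IsFT f F) (h' : IsFT g G) : IsFT (f + g) (F + G) :=
  ⟨h.memLp.add h'.memLp, h.memLp'.add h'.memLp', by
    rw [MemLp.toLp_add h.memLp h'.memLp, MemLp.toLp_add h.memLp' h'.memLp',
      FourierTransform.fourier_add, h.eq, h'.eq]⟩

theorem smul (h : IsFT f F) (c : ℂ) : IsFT (c • f) (c • F) :=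
  ⟨h.memLp.const_smul c, h.memLp'.const_smul c, by
    rw [MemLp.toLp_const_smul c h.memLp, MemLp.toLp_const_smul c h.memLp',
      FourierTransform.fourier_smul, h.eq]⟩

theorem neg (h : IsFT f F) : IsFT (-f) (-F) := by
  simpa using h.smul (-1)

theorem sub (h : IsFT f F) (h' : IsFT g G) : IsFT (f - g) (F - G) := by
  simpa [sub_eq_add_neg] using h.add h'.neg

theorem zero : IsFT (0 : E d → ℂ) 0 :=
  ⟨MemLp.zero, MemLp.zero, by
    rw [MemLp.toLp_zero]
    exact (Lp.fourierTransformₗᵢ (E d) ℂ).map_zero⟩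

theorem sum {ι : Type*} (s : Finset ι) {f F : ι → E d → ℂ} (h : ∀ i ∈ s, IsFT (f i) (F i)) :
    IsFT (∑ i ∈ s, f i) (∑ i ∈ s, F i) := by
  classical
  induction s using Finset.induction_on with
  | empty => simpa using zero
  | insert i s hi ih =>
    rw [Finset.sum_insert hi, Finset.sum_insert hi]
    exact (h i (by simp)).add (ih fun j hj ↦ h j (by simp [hj]))

theorem eLpNorm_eq (h : IsFT f F) : eLpNorm f 2 volume = eLpNorm F 2 volume := by
  have := Lp.norm_fourier_eq (h.memLp.toLp f)
  rw [h.eq, Lp.norm_toLp, Lp.norm_toLp] at this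
  exact ((ENNReal.toReal_eq_toReal_iff' h.memLp'.2.ne h.memLp.2.ne).1 this).symm

theorem integral_mul_conj (h : IsFT f F) (h' : IsFT g G) :
    ∫ x, f x * (starRingEnd ℂ) (g x) = ∫ x, F x * (starRingEnd ℂ) (G x) := by
  have := Lp.inner_fourier_eq (h'.memLp.toLp g) (h.memLp.toLp f)
  rw [h.eq, h'.eq, L2.inner_def, L2.inner_def] at this
  have e1 : ∫ x, F x * (starRingEnd ℂ) (G x) =
      ∫ x, inner ℂ ((h'.memLp'.toLp G) x) ((h.memLp'.toLp F) x) := by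
    refine integral_congr_ae ?_
    filter_upwards [h.memLp'.coeFn_toLp, h'.memLp'.coeFn_toLp] with x h1 h2
    rw [h1, h2]; rfl
  have e2 : ∫ x, f x * (starRingEnd ℂ) (g x) =
      ∫ x, inner ℂ ((h'.memLp.toLp g) x) ((h.memLp.toLp f) x) := by
    refine integral_congr_ae ?_
    filter_upwards [h.memLp.coeFn_toLp, h'.memLp.coeFn_toLp] with x h1 h2
    rw [h1, h2]; rfl
  rw [e1, e2, this]

theorem fourier_toDist (h : IsFT f F) : 𝓕 (toDist f) = (h.memLp'.toLp F : 𝓢'(E d, ℂ)) := by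
  rw [toDist_of_memLp h.memLp, Lp.fourier_toTemperedDistribution_eq, h.eq]

theorem integral_schwartz (h : IsFT f F) (ψ : 𝓢(E d, ℂ)) :
    ∫ x, ψ x * F x = ∫ x, (𝓕 ψ : 𝓢(E d, ℂ)) x * f x := by
  have := congrArg (fun u : 𝓢'(E d, ℂ) ↦ u ψ) h.fourier_toDist
  simp only [TemperedDistribution.fourier_apply] at this
  rw [toDist_of_memLp h.memLp, toLp_schwartz, toLp_schwartz] at this
  exact this.symm

/-- The Plancherel transform of `f` satisfies the same weak identity, and Schwartz functions
separate locally integrable functions. -/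
theorem of_integral_schwartz (hf : MemLp f 2 volume) (hF : LocallyIntegrable F)
    (h : ∀ ψ : 𝓢(E d, ℂ), ∫ x, ψ x * F x = ∫ x, (𝓕 ψ : 𝓢(E d, ℂ)) x * f x) : IsFT f F := by
  obtain ⟨G, hG⟩ := exists_fourier hf
  refine hG.congr ae_eq_rfl (ae_eq_of_schwartz ?_ hF fun ψ ↦ ?_)
  · exact hG.memLp'.locallyIntegrable (by norm_num)
  · rw [h, hG.integral_schwartz]

/-- A Fourier multiplier acts on the Fourier side by multiplication. -/
theorem fourierMultiplier (h : IsFT f F) {m : E d → ℂ} (hm : m.HasTemperateGrowth)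
    (hmF : MemLp (fun ξ ↦ m ξ * F ξ) 2 volume) :
    ∃ k, IsFT k (fun ξ ↦ m ξ * F ξ) ∧ fourierMultiplierCLM ℂ m (toDist f) = toDist k := by
  obtain ⟨k, hk⟩ := exists_fourierInv hmF
  refine ⟨k, hk, ?_⟩
  rw [fourierMultiplierCLM_apply, h.fourier_toDist]
  have : toDist k = 𝓕⁻ (𝓕 (toDist k)) := (FourierTransform.fourierInv_fourier_eq _).symm
  rw [this, hk.fourier_toDist]
  congr 1
  ext ψ
  rw [smulLeftCLM_apply_apply, toLp_schwartz, toLp_schwartz]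
  refine integral_congr_ae (.of_forall fun x ↦ ?_)
  simp only [SchwartzMap.smulLeftCLM_apply_apply hm, smul_eq_mul]
  ring

/-- Converse of `fourierMultiplier`: taking the Fourier transform of both sides identifies `m F`
with the transform of `k`. It turns membership in a Sobolev space into a weighted `L²` bound. -/
theorem memLp_of_fourierMultiplier (h : IsFT f F) {m : E d → ℂ} (hm : m.HasTemperateGrowth)
    {k : Lp ℂ 2 (volume : Measure (E d))}
    (hk : fourierMultiplierCLM ℂ m (toDist f) = (k : 𝓢'(E d, ℂ))) :
    MemLp (fun ξ ↦ m ξ * F ξ) 2 volume := by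
  obtain ⟨K, hK⟩ := exists_fourier (Lp.memLp k)
  rw [fourierMultiplierCLM_apply, h.fourier_toDist] at hk
  have hk' := congrArg (fun u : 𝓢'(E d, ℂ) ↦ 𝓕 u) hk
  simp only [FourierTransform.fourier_fourierInv_eq] at hk'
  have hkk : (k : 𝓢'(E d, ℂ)) = toDist k := by
    rw [toDist_of_memLp (Lp.memLp k), Lp.toLp_coeFn]
  rw [hkk, hK.fourier_toDist] at hk'
  refine hK.memLp'.ae_eq (ae_eq_of_schwartz (hK.memLp'.locallyIntegrable (by norm_num)) ?_
    fun ψ ↦ ?_)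
  · have := (h.memLp'.locallyIntegrable (by norm_num)).continuous_smul
      (g := m) hm.1.continuous
    simpa using! this
  · have := congrArg (fun u : 𝓢'(E d, ℂ) ↦ u ψ) hk'
    simp only [smulLeftCLM_apply_apply] at this
    rw [toLp_schwartz, toLp_schwartz] at this
    rw [← this]
    refine integral_congr_ae (.of_forall fun x ↦ ?_)
    simp only [SchwartzMap.smulLeftCLM_apply_apply hm, smul_eq_mul]
    ring

end IsFT

/-! ### Distributions described by their Fourier transforms -/

/-- The real Bessel weight `(1 + |2πξ|²)^{σ/2}`. -/
def jw (σ : ℝ) (ξ : E d) : ℝ := (1 + ‖(2 * Real.pi) • ξ‖ ^ 2) ^ (σ / 2)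

/-- The symbol of `∂_i`. -/
def dSymbol (i : Fin d) (ξ : E d) : ℂ := 2 * Real.pi * Complex.I * (ξ i : ℂ)

/-- The `L²` norm of `F` with weight `m`. -/
def wN (m : E d → ℝ) (F : E d → ℂ) : ℝ≥0∞ := eLpNorm (fun ξ ↦ (m ξ : ℂ) * F ξ) 2 volume

/-- The distribution `u` is a square integrable function with Fourier transform `F`. -/
def DistFT (u : 𝓢'(E d, ℂ)) (F : E d → ℂ) : Prop := ∃ f, IsFT f F ∧ u = toDist f

theorem IsFT.distFT {f F : E d → ℂ} (h : IsFT f F) : DistFT (toDist f) F := ⟨f, h, rfl⟩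

namespace DistFT

variable {u w : 𝓢'(E d, ℂ)} {F G : E d → ℂ}

theorem add (h : DistFT u F) (h' : DistFT w G) : DistFT (u + w) (F + G) := by
  obtain ⟨f, hf, rfl⟩ := h
  obtain ⟨g, hg, rfl⟩ := h'
  refine ⟨f + g, hf.add hg, ?_⟩
  rw [toDist_of_memLp hf.memLp, toDist_of_memLp hg.memLp,
    toDist_of_memLp (hf.memLp.add hg.memLp), MemLp.toLp_add hf.memLp hg.memLp]
  exact ((Lp.toTemperedDistributionCLM ℂ volume 2).map_add _ _).symm

theorem smul (h : DistFT u F) (c : ℂ) : DistFT (c • u) (c • F) := by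
  obtain ⟨f, hf, rfl⟩ := h
  refine ⟨c • f, hf.smul c, ?_⟩
  rw [toDist_of_memLp hf.memLp, toDist_of_memLp (hf.memLp.const_smul c),
    MemLp.toLp_const_smul c hf.memLp]
  exact ((Lp.toTemperedDistributionCLM ℂ volume 2).map_smul _ _).symm

theorem sub (h : DistFT u F) (h' : DistFT w G) : DistFT (u - w) (F - G) := by
  have := h.add (h'.smul (-1))
  rwa [neg_one_smul ℂ w, neg_one_smul ℂ G, ← sub_eq_add_neg, ← sub_eq_add_neg] at this

theorem zero : DistFT (0 : 𝓢'(E d, ℂ)) 0 := by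
  have := (DistFT.smul (IsFT.zero (d := d)).distFT 0)
  rwa [zero_smul ℂ (toDist (0 : E d → ℂ)), smul_zero] at this

theorem sum {ι : Type*} (s : Finset ι) {u : ι → 𝓢'(E d, ℂ)} {F : ι → E d → ℂ}
    (h : ∀ i ∈ s, DistFT (u i) (F i)) : DistFT (∑ i ∈ s, u i) (∑ i ∈ s, F i) := by
  classical
  induction s using Finset.induction_on with
  | empty => simpa using zero
  | insert i s hi ih =>
    rw [Finset.sum_insert hi, Finset.sum_insert hi]
    exact (h i (by simp)).add (ih fun j hj ↦ h j (by simp [hj]))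

theorem sobolevNorm_eq (h : DistFT u F) {σ : ℝ}
    (hF : MemLp (fun ξ ↦ (jw σ ξ : ℂ) * F ξ) 2 volume) :
    sobolevNorm σ u = (wN (jw σ) F).toReal := by
  obtain ⟨f, hf, rfl⟩ := h
  obtain ⟨k, hk, e⟩ := hf.fourierMultiplier (besselSymbol_hasTemperateGrowth d σ) hF
  rw [toDist_of_memLp hk.memLp] at e
  rw [WeightedFriedrichs.sobolevNorm_eq (f := hk.memLp.toLp k) e, Lp.norm_toLp, hk.eLpNorm_eq]
  rfl

theorem memSobolev_iff (h : DistFT u F) {σ : ℝ} :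
    MemSobolev σ 2 u ↔ MemLp (fun ξ ↦ (jw σ ξ : ℂ) * F ξ) 2 volume := by
  obtain ⟨f, hf, rfl⟩ := h
  rw [memSobolev_iff_bessel]
  constructor
  · rintro ⟨k, hk⟩
    exact hf.memLp_of_fourierMultiplier (besselSymbol_hasTemperateGrowth d σ) hk
  · intro hF
    obtain ⟨k, hk, e⟩ := hf.fourierMultiplier (besselSymbol_hasTemperateGrowth d σ) hF
    rw [toDist_of_memLp hk.memLp] at e
    exact ⟨_, e⟩

theorem lineDeriv (h : DistFT u F) (i : Fin d)
    (hF : MemLp (fun ξ ↦ dSymbol i ξ * F ξ) 2 volume) :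
    DistFT (∂_{e i} u) (fun ξ ↦ dSymbol i ξ * F ξ) := by
  obtain ⟨f, hf, rfl⟩ := h
  have hc : (2 * Real.pi * Complex.I) ≠ 0 := by simp [Real.pi_ne_zero]
  have hi : ∀ ξ : E d, inner ℝ ξ (e i) = ξ i := fun ξ ↦ by simp [e, EuclideanSpace.inner_single_right]
  have hF' : MemLp (fun ξ : E d ↦ ((inner ℝ ξ (e i) : ℝ) : ℂ) * F ξ) 2 volume := by
    convert! hF.const_mul (2 * Real.pi * Complex.I)⁻¹ using 2 with ξ
    rw [hi, dSymbol]
    field_simp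
  obtain ⟨k, hk, e'⟩ := hf.fourierMultiplier (m := fun ξ ↦ ((inner ℝ ξ (e i) : ℝ) : ℂ))
    (by fun_prop) hF'
  rw [lineDeriv_eq_fourierMultiplierCLM, e']
  convert hk.distFT.smul (2 * Real.pi * Complex.I) using 1
  ext ξ
  simp only [Pi.smul_apply, smul_eq_mul, hi, dSymbol]
  ring

end DistFT

/-! ### Products and convolutions -/

/-- The convolution of two scalar functions. -/
def conv (F G : E d → ℂ) (ξ : E d) : ℂ := ∫ t, F t * G (ξ - t)

theorem aestronglyMeasurable_conv_integrand {F G : E d → ℂ} (hF : AEStronglyMeasurable F volume)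
    (hG : AEStronglyMeasurable G volume) :
    AEStronglyMeasurable (fun p : E d × E d ↦ F p.2 * G (p.1 - p.2)) (volume.prod volume) :=
  hF.convolution_integrand (ContinuousLinearMap.mul ℝ ℂ) hG

theorem aestronglyMeasurable_conv {F G : E d → ℂ} (hF : AEStronglyMeasurable F volume)
    (hG : AEStronglyMeasurable G volume) : AEStronglyMeasurable (conv F G) volume :=
  (aestronglyMeasurable_conv_integrand hF hG).integral_prod_right'

namespace IsFT

variable {f g F G : E d → ℂ}

/-- The `L²` inverse transform agrees with the inversion integral as soon as the latter converges,
by the multiplication formula against Schwartz functions. All sup bounds below come from this. -/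
theorem ae_eq_fourierInv (h : IsFT f F) (hF : Integrable F) : f =ᵐ[volume] 𝓕⁻ F := by
  have hc : Continuous (𝓕⁻ F) := by
    have := VectorFourier.fourierIntegral_continuous (V := E d) (W := E d) (μ := volume)
      Real.continuous_fourierChar (L := -innerₗ (E d)) (by change Continuous fun p : E d × E d ↦ -inner ℝ p.1 p.2; fun_prop) hF
    exact this
  refine ae_eq_of_schwartz (h.memLp.locallyIntegrable (by norm_num)) hc.locallyIntegrable
    fun ψ ↦ ?_
  have h1 := h.integral_schwartz (𝓕⁻ ψ)
  rw [FourierTransform.fourier_fourierInv_eq] at h1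
  rw [← h1]
  have := VectorFourier.integral_fourierIntegral_smul_eq_flip (V := E d) (W := E d)
    (μ := volume) (ν := volume) (L := -innerₗ (E d)) Real.continuous_fourierChar
    (by change Continuous fun p : E d × E d ↦ -inner ℝ p.1 p.2; fun_prop) (f := ψ) (g := F) ψ.integrable hF
  simp only [smul_eq_mul] at this
  have e1 : ∀ ξ, VectorFourier.fourierIntegral Real.fourierChar volume (-innerₗ (E d)) ψ ξ
      = (𝓕⁻ ψ) ξ := fun ξ ↦ by
    rw [SchwartzMap.fourierInv_coe]; rfl
  have e2 : ∀ ξ, VectorFourier.fourierIntegral Real.fourierChar volume (-innerₗ (E d)).flip F ξ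
      = (𝓕⁻ F) ξ := fun ξ ↦ by
    rw [Real.fourierInv_eq]
    simp [VectorFourier.fourierIntegral, real_inner_comm]
  simpa only [e1, e2] using this

theorem norm_le_integral (h : IsFT f F) (hF : Integrable F) :
    ∀ᵐ x, ‖f x‖ ≤ ∫ ξ, ‖F ξ‖ := by
  filter_upwards [h.ae_eq_fourierInv hF] with x hx
  rw [hx, Real.fourierInv_eq]
  refine (norm_integral_le_integral_norm _).trans_eq ?_
  simp

/-- A translation on the Fourier side is multiplication by a character in `x`; integrated against `F
t`, this character rebuilds `𝓕⁻ F`. -/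
theorem integral_schwartz_shift (h : IsFT g G) (ψ : 𝓢(E d, ℂ)) (t : E d) :
    ∫ ξ, ψ ξ * G (ξ - t)
      = ∫ x, (Real.fourierChar (inner ℝ t x) : ℂ) * ((𝓕 ψ : 𝓢(E d, ℂ)) x * g x) := by
  have h1 := h.integral_schwartz (ψ.compSubConstCLM ℂ (-t))
  have h2 : ∫ ξ, ψ ξ * G (ξ - t) = ∫ ξ, (ψ.compSubConstCLM ℂ (-t)) ξ * G ξ := by
    rw [← integral_add_right_eq_self _ t]
    simp
  rw [h2, h1]
  refine integral_congr_ae (.of_forall fun x ↦ ?_)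
  have h3 := VectorFourier.fourierIntegral_comp_add_right (V := E d) (W := E d)
    Real.fourierChar volume (innerₗ (E d)) ψ t
  have h4 := congrFun h3 x
  have h5 : (𝓕 (ψ.compSubConstCLM ℂ (-t))) x
      = (Real.fourierChar (inner ℝ t x) : ℂ) * (𝓕 ψ : 𝓢(E d, ℂ)) x := by
    rw [SchwartzMap.fourier_coe, SchwartzMap.fourier_coe]
    rw [Circle.smul_def] at h4
    have h6 : ⇑(ψ.compSubConstCLM ℂ (-t)) = ψ ∘ fun v ↦ v + t := by
      ext y
      simp
    rw [h6]
    exact h4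
  simp only
  rw [h5]
  ring

/-- By `2ab ≤ a² + b²` the integrand is dominated by `|ψ|² |F|` and `|F| |G|²`, both integrable on
the product; this justifies Fubini. -/
theorem integrable_schwartz_mul_conv (hF : Integrable F) (hG : MemLp G 2 volume) (ψ : 𝓢(E d, ℂ)) :
    Integrable (fun p : E d × E d ↦ ψ p.1 * (F p.2 * G (p.1 - p.2))) (volume.prod volume) := by
  have hψ2 : Integrable fun ξ ↦ ‖ψ ξ‖ ^ 2 := (ψ.memLp 2).integrable_norm_pow (by norm_num)
  have hG2 : Integrable fun ξ ↦ ‖G ξ‖ ^ 2 := hG.integrable_norm_pow (by norm_num)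
  have hm := aestronglyMeasurable_conv_integrand hF.1 hG.1
  have i1 : Integrable (fun p : E d × E d ↦ ‖ψ p.1‖ ^ 2 * ‖F p.2‖) (volume.prod volume) :=
    hψ2.mul_prod hF.norm
  have i2 : Integrable (fun p : E d × E d ↦ ‖F p.2‖ * ‖G (p.1 - p.2)‖ ^ 2)
      (volume.prod volume) := hF.norm.convolution_integrand (ContinuousLinearMap.mul ℝ ℝ) hG2
  refine (i1.add i2).mono' (ψ.continuous.aestronglyMeasurable.comp_fst.mul hm)
    (.of_forall fun p ↦ ?_)
  simp only [norm_mul, Pi.add_apply]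
  generalize ‖ψ p.1‖ = a
  generalize ‖G (p.1 - p.2)‖ = b
  have hc : 0 ≤ ‖F p.2‖ := norm_nonneg _
  generalize ‖F p.2‖ = c at hc
  nlinarith [mul_nonneg hc (sq_nonneg (a - b)), mul_nonneg hc (sq_nonneg a),
    mul_nonneg hc (sq_nonneg b)]

theorem integrable_char_mul {k : E d → ℂ} (hF : Integrable F) (hk : Integrable k) :
    Integrable (fun p : E d × E d ↦
      F p.1 * ((Real.fourierChar (inner ℝ p.1 p.2) : ℂ) * k p.2)) (volume.prod volume) := by
  refine (hF.mul_prod hk).mono ?_ (.of_forall fun p ↦ by simp [Circle.norm_coe])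
  refine hF.1.comp_fst.mul (AEStronglyMeasurable.mul ?_ hk.1.comp_snd)
  have : Continuous fun p : E d × E d ↦ (Real.fourierChar (inner ℝ p.1 p.2) : ℂ) :=
    continuous_subtype_val.comp (Real.continuous_fourierChar.comp (by fun_prop))
  exact this.aestronglyMeasurable

theorem integral_char_swap {k : E d → ℂ} (hF : Integrable F) (hk : Integrable k) :
    ∫ t, ∫ x, F t * ((Real.fourierChar (inner ℝ t x) : ℂ) * k x) =
      ∫ x, ∫ t, F t * ((Real.fourierChar (inner ℝ t x) : ℂ) * k x) :=
  integral_integral_swap (f := fun t x ↦ F t * ((Real.fourierChar (inner ℝ t x) : ℂ) * k x))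
    (integrable_char_mul hF hk)

theorem memLp_mul (h : IsFT f F) (hF : Integrable F) (hg : MemLp g 2 volume) :
    MemLp (f * g) 2 volume := by
  refine MemLp.of_le_mul (c := ∫ ξ, ‖F ξ‖) hg (h.memLp.1.mul hg.1) ?_
  filter_upwards [h.norm_le_integral hF] with x hx
  rw [Pi.mul_apply, norm_mul]
  gcongr

theorem integral_schwartz_conv (h' : IsFT g G) (hF : Integrable F) (ψ : 𝓢(E d, ℂ)) :
    ∫ ξ, ψ ξ * conv F G ξ
      = ∫ x, ∫ t, F t * ((Real.fourierChar (inner ℝ t x) : ℂ) *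
          ((𝓕 ψ : 𝓢(E d, ℂ)) x * g x)) := by
  have hψg : Integrable fun x ↦ (𝓕 ψ : 𝓢(E d, ℂ)) x * g x :=
    ((𝓕 ψ : 𝓢(E d, ℂ)).memLp 2).integrable_mul h'.memLp
  have e1 : ∫ ξ, ψ ξ * conv F G ξ = ∫ ξ, ∫ t, ψ ξ * (F t * G (ξ - t)) := by
    refine integral_congr_ae (.of_forall fun ξ ↦ ?_)
    exact (integral_const_mul _ _).symm
  have e2 : ∫ ξ, ∫ t, ψ ξ * (F t * G (ξ - t)) = ∫ t, ∫ ξ, ψ ξ * (F t * G (ξ - t)) :=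
    integral_integral_swap (integrable_schwartz_mul_conv hF h'.memLp' ψ)
  have e3 : ∫ t, ∫ x, F t * ((Real.fourierChar (inner ℝ t x) : ℂ) *
          ((𝓕 ψ : 𝓢(E d, ℂ)) x * g x)) = ∫ x, ∫ t, F t * ((Real.fourierChar (inner ℝ t x) : ℂ) *
          ((𝓕 ψ : 𝓢(E d, ℂ)) x * g x)) :=
    integral_char_swap hF hψg
  rw [e1, e2, ← e3]
  refine integral_congr_ae (.of_forall fun t ↦ ?_)
  simp only
  rw [integral_const_mul, ← h'.integral_schwartz_shift, ← integral_const_mul]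
  refine integral_congr_ae (.of_forall fun ξ ↦ ?_)
  simp only
  ring

theorem integral_char_mul (F : E d → ℂ) (c : ℂ) (x : E d) :
    ∫ t, F t * ((Real.fourierChar (inner ℝ t x) : ℂ) * c) = 𝓕⁻ F x * c := by
  rw [Real.fourierInv_eq, ← integral_mul_const]
  refine integral_congr_ae (.of_forall fun t ↦ ?_)
  simp only
  rw [Circle.smul_def, smul_eq_mul]
  ring

/-- The Fourier transform of a product is the convolution of the Fourier transforms. -/
theorem mul (h : IsFT f F) (h' : IsFT g G) (hF : Integrable F)
    (hFG : MemLp (conv F G) 2 volume) : IsFT (f * g) (conv F G) := by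
  refine of_integral_schwartz (h.memLp_mul hF h'.memLp) (hFG.locallyIntegrable (by norm_num))
    fun ψ ↦ ?_
  rw [h'.integral_schwartz_conv hF]
  refine integral_congr_ae ?_
  filter_upwards [h.ae_eq_fourierInv hF] with x hx
  rw [integral_char_mul, ← hx, Pi.mul_apply]
  ring

end IsFT

open scoped NNReal

/-! ### Inhomogeneous and homogeneous weights -/

/-- The symbol `1 + |2πξ|²` of `I - Δ`. -/
def jap (ξ : E d) : ℝ := 1 + ‖(2 * Real.pi) • ξ‖ ^ 2

theorem one_le_jap (ξ : E d) : 1 ≤ jap ξ := by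
  unfold jap; nlinarith [sq_nonneg ‖(2 * Real.pi) • ξ‖]

theorem jap_pos (ξ : E d) : 0 < jap ξ := zero_lt_one.trans_le (one_le_jap ξ)

theorem jw_eq (σ : ℝ) (ξ : E d) : jw σ ξ = jap ξ ^ (σ / 2) := rfl

theorem jw_pos (σ : ℝ) (ξ : E d) : 0 < jw σ ξ := Real.rpow_pos_of_pos (jap_pos ξ) _

theorem jw_sq (σ : ℝ) (ξ : E d) : jw σ ξ ^ 2 = jap ξ ^ σ := by
  rw [jw_eq, ← Real.rpow_mul_natCast (jap_pos ξ).le]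
  congr 1
  push_cast
  ring

@[fun_prop]
theorem measurable_jw (σ : ℝ) : Measurable (jw σ : E d → ℝ) := by
  unfold jw; fun_prop

theorem jap_le_four_mul_max (ξ t : E d) : jap ξ ≤ 4 * max (jap t) (jap (ξ - t)) := by
  have h : ‖(2 * Real.pi) • ξ‖ ≤ ‖(2 * Real.pi) • t‖ + ‖(2 * Real.pi) • (ξ - t)‖ := by
    refine le_trans (le_of_eq ?_) (norm_add_le _ _)
    rw [← smul_add, add_sub_cancel]
  unfold jap
  have h0 := norm_nonneg ((2 * Real.pi) • ξ)
  have h1 := le_max_left (1 + ‖(2 * Real.pi) • t‖ ^ 2) (1 + ‖(2 * Real.pi) • (ξ - t)‖ ^ 2)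
  have h2 := le_max_right (1 + ‖(2 * Real.pi) • t‖ ^ 2) (1 + ‖(2 * Real.pi) • (ξ - t)‖ ^ 2)
  nlinarith [sq_nonneg (‖(2 * Real.pi) • t‖ - ‖(2 * Real.pi) • (ξ - t)‖)]

theorem integrable_jap_rpow {b : ℝ} (hb : (d : ℝ) / 2 < b) :
    Integrable fun ξ : E d ↦ jap ξ ^ (-b) := by
  have h := integrable_rpow_neg_one_add_norm_sq (E := E d) (μ := volume) (r := 2 * b)
    (by simp; linarith)
  have h2 : (2 * Real.pi) ≠ 0 := by simp [Real.pi_ne_zero]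
  have := h.comp_smul h2
  refine this.congr (.of_forall fun ξ ↦ ?_)
  simp only [jap]
  congr 1
  ring

/-- The weights `m` that dominate `(1 + |ξ|²)^{b/2}` up to an integrable singularity. -/
structure Admissible (b : ℝ) (m : E d → ℝ) : Prop where
  measurable : Measurable m
  bound : ∃ h : E d → ℝ, Integrable h ∧ (∀ ξ, 0 ≤ h ξ) ∧
    ∀ᵐ ξ, 0 < m ξ ∧ (m ξ ^ 2)⁻¹ ≤ jap ξ ^ (-b) * (2 + h ξ)

theorem admissible_jw (b : ℝ) : Admissible b (jw b : E d → ℝ) := by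
  refine ⟨by fun_prop, 0, integrable_zero _ _ _, fun _ ↦ le_rfl, .of_forall fun ξ ↦
    ⟨jw_pos b ξ, ?_⟩⟩
  rw [jw_sq, Real.rpow_neg (jap_pos ξ).le]
  have := inv_nonneg.2 (Real.rpow_nonneg (jap_pos ξ).le b)
  simp only [Pi.zero_apply]
  linarith

/-- The homogeneous weight `|2πξ| (1 + |2πξ|²)^{b/2}`. -/
def hw (b : ℝ) (ξ : E d) : ℝ := ‖(2 * Real.pi) • ξ‖ * jw b ξ

@[fun_prop]
theorem measurable_hw (b : ℝ) : Measurable (hw b : E d → ℝ) := by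
  unfold hw; fun_prop

theorem hw_nonneg (b : ℝ) (ξ : E d) : 0 ≤ hw b ξ := mul_nonneg (norm_nonneg _) (jw_pos b ξ).le

/-- The dimension enters here: `|ξ|⁻²` is integrable near the origin exactly when `d > 2`. -/
theorem integrable_inv_norm_sq (hd : 3 ≤ d) :
    Integrable ((Metric.ball (0 : E d) 1).indicator fun ξ ↦ (‖ξ‖ ^ 2)⁻¹) := by
  rw [integrable_indicator_iff Metric.isOpen_ball.measurableSet]
  have hd' : (3 : ℝ) ≤ d := by exact_mod_cast hd
  refine integrableOn_ball_of_norm_le_rpow (C := 1) (α := 2) (by simp; omega)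
    (by simp; linarith) (.of_forall fun ξ ↦ ?_) (Measurable.aestronglyMeasurable (by fun_prop))
  rw [Real.rpow_neg (norm_nonneg _), Real.rpow_two, one_mul, norm_inv, norm_pow, norm_norm]

/-- With `η = 2πξ`, the inverse square of the weight is `jap ξ ^ (-b) * (1 + |η|⁻²)`. The bracket is
at most `2` outside the unit ball, and inside it the singular term is integrable. Thus homogeneous
norms, blind to low frequencies, still control products and sup norms. -/
theorem admissible_hw (hd : 3 ≤ d) (b : ℝ) : Admissible b (hw (b - 1) : E d → ℝ) := by
  refine ⟨by fun_prop, fun ξ ↦ (Metric.ball (0 : E d) 1).indicator (fun ξ ↦ (‖ξ‖ ^ 2)⁻¹)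
    ((2 * Real.pi) • ξ), ?_, fun ξ ↦ Set.indicator_nonneg (fun _ _ ↦ by positivity) _, ?_⟩
  · exact (integrable_inv_norm_sq hd).comp_smul (by simp [Real.pi_ne_zero])
  have : NeZero d := ⟨by omega⟩
  have h0 : ∀ᵐ ξ : E d, ξ ≠ 0 := by
    have : Nontrivial (E d) := by
      apply Module.nontrivial_of_finrank_pos (R := ℝ); simp; omega
    exact Measure.ae_ne volume 0
  filter_upwards [h0] with ξ hξ
  have hn : 0 < ‖(2 * Real.pi) • ξ‖ := by
    rw [norm_pos_iff]; simp [Real.pi_ne_zero, hξ]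
  refine ⟨mul_pos hn (jw_pos _ _), ?_⟩
  have hj : jap ξ ^ (-b) = (jap ξ ^ (b - 1))⁻¹ * (jap ξ)⁻¹ := by
    rw [← Real.rpow_neg (jap_pos ξ).le, ← Real.rpow_neg_one (jap ξ), ← Real.rpow_add (jap_pos ξ)]
    congr 1; ring
  rw [hw, mul_pow, jw_sq, mul_inv, hj, mul_assoc, mul_comm]
  refine mul_le_mul_of_nonneg_left ?_ (inv_nonneg.2 (Real.rpow_nonneg (jap_pos ξ).le _))
  rw [inv_mul_eq_div, le_div_iff₀ (jap_pos ξ)]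
  unfold jap
  generalize (2 * Real.pi) • ξ = η at *
  by_cases h1 : η ∈ Metric.ball (0 : E d) 1
  · rw [Set.indicator_of_mem h1, mul_add, inv_mul_cancel₀ (by positivity)]
    linarith
  · rw [Set.indicator_of_notMem h1]
    have : 1 ≤ ‖η‖ := by simpa using h1
    rw [inv_mul_le_iff₀ (by positivity)]
    nlinarith

/-- A pointwise bound for the kernel of the weighted convolution estimate. -/
theorem jap_kernel_bound {a b : ℝ} (ha : 0 ≤ a) (hab : a ≤ b) (ξ t : E d) :
    jap ξ ^ a * jap t ^ (-a) * jap (ξ - t) ^ (-b)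
      ≤ 4 ^ a * (2 * jap (ξ - t) ^ (-b) + jap t ^ (-b)) := by
  have hx := one_le_jap t
  have hy := one_le_jap (ξ - t)
  have hm := jap_le_four_mul_max ξ t
  have hz := jap_pos ξ
  generalize jap t = x at *
  generalize jap (ξ - t) = y at *
  generalize jap ξ = z at *
  have hx0 : 0 < x := by linarith
  have hy0 : 0 < y := by linarith
  have h4 : (0 : ℝ) ≤ 4 ^ a := by positivity
  have hxa : x ^ a * x ^ (-a) = 1 := by rw [← Real.rpow_add hx0]; simp
  have hya : y ^ a * y ^ (-b) = y ^ (a - b) := by rw [← Real.rpow_add hy0]; ring_nf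
  have hxb : 0 < x ^ (-b) := by positivity
  have hyb : 0 < y ^ (-b) := by positivity
  have hxa' : 0 < x ^ (-a) := by positivity
  -- The larger of `x`, `y` absorbs `z ^ a`. If it is `y`, the remaining `y ^ (a - b)` has
  -- nonpositive exponent and is at most `x ^ (a - b)`.
  rcases le_total y x with h | h
  · rw [max_eq_left h] at hm
    have : z ^ a ≤ 4 ^ a * x ^ a := by
      rw [← Real.mul_rpow (by norm_num) hx0.le]
      exact Real.rpow_le_rpow hz.le hm ha
    calc z ^ a * x ^ (-a) * y ^ (-b) ≤ (4 ^ a * x ^ a) * x ^ (-a) * y ^ (-b) := by gcongr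
      _ = 4 ^ a * y ^ (-b) := by rw [mul_assoc (4 ^ a), hxa, mul_one]
      _ ≤ _ := by gcongr; linarith
  · rw [max_eq_right h] at hm
    have : z ^ a ≤ 4 ^ a * y ^ a := by
      rw [← Real.mul_rpow (by norm_num) hy0.le]
      exact Real.rpow_le_rpow hz.le hm ha
    calc z ^ a * x ^ (-a) * y ^ (-b) ≤ (4 ^ a * y ^ a) * x ^ (-a) * y ^ (-b) := by gcongr
      _ = 4 ^ a * (x ^ (-a) * y ^ (a - b)) := by rw [← hya]; ring
      _ ≤ 4 ^ a * (x ^ (-a) * x ^ (a - b)) := by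
        have := Real.rpow_le_rpow_of_nonpos hx0 h (by linarith : a - b ≤ 0)
        gcongr
      _ = 4 ^ a * x ^ (-b) := by rw [← Real.rpow_add hx0]; ring_nf
      _ ≤ _ := by gcongr; linarith

theorem jap_kernel_le {a b : ℝ} (ha : 0 ≤ a) (hab : a ≤ b) (ξ t : E d) :
    jap ξ ^ a * jap t ^ (-a) * jap (ξ - t) ^ (-b) ≤ 3 * 4 ^ a := by
  have h1 : ∀ η : E d, jap η ^ (-b) ≤ 1 := fun η ↦
    Real.rpow_le_one_of_one_le_of_nonpos (one_le_jap η) (by linarith)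
  have h4 : (0 : ℝ) ≤ 4 ^ a := by positivity
  refine (jap_kernel_bound ha hab ξ t).trans ?_
  nlinarith [h1 t, h1 (ξ - t)]

/-! ### Weighted Young inequality -/

theorem sq_lintegral_mul_le {α : Type*} [MeasurableSpace α] {μ : Measure α} {u v : α → ℝ≥0∞}
    (hu : AEMeasurable u μ) (hv : AEMeasurable v μ) :
    (∫⁻ x, u x * v x ∂μ) ^ 2 ≤ (∫⁻ x, u x ^ 2 ∂μ) * ∫⁻ x, v x ^ 2 ∂μ := by
  have h := ENNReal.lintegral_mul_le_Lp_mul_Lq μ (p := 2) (q := 2)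
    (by constructor <;> norm_num) hu hv
  simp only [Pi.mul_apply, ENNReal.rpow_two] at h
  calc (∫⁻ x, u x * v x ∂μ) ^ 2
      ≤ ((∫⁻ x, u x ^ 2 ∂μ) ^ (1 / 2 : ℝ) * (∫⁻ x, v x ^ 2 ∂μ) ^ (1 / 2 : ℝ)) ^ 2 := by gcongr
    _ = _ := by
      rw [mul_pow, ← ENNReal.rpow_mul_natCast, ← ENNReal.rpow_mul_natCast]
      norm_num

theorem wN_sq (m : E d → ℝ) (F : E d → ℂ) : wN m F ^ 2 = ∫⁻ ξ, ‖(m ξ : ℂ) * F ξ‖ₑ ^ 2 := by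
  have := eLpNorm_nnreal_pow_eq_lintegral (f := fun ξ ↦ (m ξ : ℂ) * F ξ)
    (μ := (volume : Measure (E d))) (p := 2) (by norm_num)
  simpa [wN] using this

/-- In the factor `2 + h`, the constant is paired with the kernel bound that is integrable in `t`,
and `h` with the uniform one. All resulting integrals are translation invariant, hence independent
of `ξ`. -/
theorem Admissible.exists_kernel_bound {a b : ℝ} {m : E d → ℝ} (hm : Admissible b m) (ha : 0 ≤ a)
    (hab : a ≤ b) (hb : (d : ℝ) / 2 < b) :
    ∃ K : ℝ≥0, ∀ ξ : E d,
      ∫⁻ t, ENNReal.ofReal (jw a ξ * (jw a t)⁻¹ * (m (ξ - t))⁻¹) ^ 2 ≤ (K : ℝ≥0∞) ^ 2 := by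
  obtain ⟨h, hh, hh0, hmh⟩ := hm.bound
  set I := ∫ ξ : E d, jap ξ ^ (-b) with hI
  have hJ := integrable_jap_rpow (d := d) hb
  -- `6 = 4 + 2` is twice the coefficients in `jap_kernel_bound`; `3` is the constant of
  -- `jap_kernel_le`.
  set k := 4 ^ a * (6 * I + 3 * ∫ ξ, h ξ) with hk
  have hI0 : 0 ≤ I := integral_nonneg fun ξ ↦ (Real.rpow_pos_of_pos (jap_pos ξ) _).le
  have hk0 : 0 ≤ k := by
    have : 0 ≤ ∫ ξ, h ξ := integral_nonneg fun ξ ↦ hh0 ξ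
    positivity
  refine ⟨Real.toNNReal (Real.sqrt k), fun ξ ↦ ?_⟩
  have hK : ((Real.toNNReal (Real.sqrt k) : ℝ≥0) : ℝ≥0∞) ^ 2 = ENNReal.ofReal k := by
    rw [← ENNReal.ofReal, ← ENNReal.ofReal_pow (Real.sqrt_nonneg _), Real.sq_sqrt hk0]
  rw [hK]
  have hqm := (Measure.measurePreserving_sub_left (volume : Measure (E d)) ξ).quasiMeasurePreserving
  have hae := hqm.ae hmh
  let H : E d → ℝ := fun t ↦
    4 ^ a * (4 * jap (ξ - t) ^ (-b) + 2 * jap t ^ (-b) + 3 * h (ξ - t))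
  have hHi : Integrable H := by
    refine Integrable.const_mul (((hJ.comp_sub_left ξ).const_mul 4).add (hJ.const_mul 2) |>.add
      ((hh.comp_sub_left ξ).const_mul 3)) _
  have hHint : ∫ t, H t = k := by
    simp only [H]
    rw [integral_const_mul, integral_add
      (f := fun t ↦ 4 * jap (ξ - t) ^ (-b) + 2 * jap t ^ (-b)) (((hJ.comp_sub_left ξ).const_mul 4).add (hJ.const_mul 2))
      ((hh.comp_sub_left ξ).const_mul 3), integral_add ((hJ.comp_sub_left ξ).const_mul 4)
      (hJ.const_mul 2), integral_const_mul, integral_const_mul, integral_const_mul,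
      integral_sub_left_eq_self (fun η ↦ jap η ^ (-b)) volume ξ,
      integral_sub_left_eq_self h volume ξ]
    rw [hk, ← hI]; ring
  calc ∫⁻ t, ENNReal.ofReal (jw a ξ * (jw a t)⁻¹ * (m (ξ - t))⁻¹) ^ 2
      ≤ ∫⁻ t, ENNReal.ofReal (H t) := by
        refine lintegral_mono_ae ?_
        filter_upwards [hae] with t ht
        obtain ⟨h1, h2⟩ := ht
        rw [← ENNReal.ofReal_pow (mul_nonneg (mul_nonneg (jw_pos _ _).le
          (inv_nonneg.2 (jw_pos _ _).le)) (inv_nonneg.2 h1.le))]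
        refine ENNReal.ofReal_le_ofReal ?_
        rw [mul_pow, mul_pow, inv_pow, inv_pow, jw_sq, jw_sq, ← Real.rpow_neg (jap_pos t).le]
        have p1 : 0 ≤ jap ξ ^ a * jap t ^ (-a) :=
          mul_nonneg (Real.rpow_nonneg (jap_pos _).le _) (Real.rpow_nonneg (jap_pos _).le _)
        calc jap ξ ^ a * jap t ^ (-a) * (m (ξ - t) ^ 2)⁻¹
            ≤ jap ξ ^ a * jap t ^ (-a) * (jap (ξ - t) ^ (-b) * (2 + h (ξ - t))) := by gcongr
          _ = 2 * (jap ξ ^ a * jap t ^ (-a) * jap (ξ - t) ^ (-b)) +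
              (jap ξ ^ a * jap t ^ (-a) * jap (ξ - t) ^ (-b)) * h (ξ - t) := by ring
          _ ≤ 2 * (4 ^ a * (2 * jap (ξ - t) ^ (-b) + jap t ^ (-b))) +
              3 * 4 ^ a * h (ξ - t) := by
            have := jap_kernel_bound ha hab ξ t
            have := jap_kernel_le ha hab ξ t
            have := hh0 (ξ - t)
            gcongr
          _ = H t := by simp only [H]; ring
    _ = ENNReal.ofReal (∫ t, H t) := by
        rw [ofReal_integral_eq_lintegral_ofReal hHi (.of_forall fun t ↦ ?_)]
        have := hh0 (ξ - t)
        have := Real.rpow_nonneg (jap_pos (ξ - t)).le (-b)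
        have := Real.rpow_nonneg (jap_pos t).le (-b)
        simp only [H, Pi.zero_apply]
        positivity
    _ = ENNReal.ofReal k := by rw [hHint]

/-- Young-type estimate for convolutions in weighted spaces. -/
theorem Admissible.exists_wN_conv_le {a b : ℝ} {m : E d → ℝ} (hm : Admissible b m) (ha : 0 ≤ a)
    (hab : a ≤ b) (hb : (d : ℝ) / 2 < b) :
    ∃ K : ℝ≥0, ∀ F G : E d → ℂ, AEStronglyMeasurable F volume → AEStronglyMeasurable G volume →
      wN (jw a) (conv F G) ≤ K * wN (jw a) F * wN m G := by
  obtain ⟨K, hK⟩ := hm.exists_kernel_bound ha hab hb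
  refine ⟨K, fun F G hF hG ↦ ?_⟩
  obtain ⟨h, hh, hh0, hmh⟩ := hm.bound
  have hmm := hm.measurable
  rw [← ENNReal.pow_le_pow_left_iff (two_ne_zero), mul_pow, mul_pow, wN_sq, wN_sq, wN_sq]
  set f : E d → ℝ≥0∞ := fun t ↦ ‖(jw a t : ℂ) * F t‖ₑ with hf
  set g : E d → ℝ≥0∞ := fun t ↦ ‖(m t : ℂ) * G t‖ₑ with hg
  have hfm' : AEStronglyMeasurable (fun t ↦ (jw a t : ℂ) * F t) volume :=
    (Measurable.aestronglyMeasurable (by fun_prop)).mul hF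
  have hgm' : AEStronglyMeasurable (fun t ↦ (m t : ℂ) * G t) volume :=
    (Measurable.aestronglyMeasurable (by fun_prop)).mul hG
  have hfm : AEMeasurable f volume := hfm'.enorm
  have hgm : AEMeasurable g volume := hgm'.enorm
  have hqm : ∀ ξ : E d, Measure.QuasiMeasurePreserving (fun t ↦ ξ - t) volume volume := fun ξ ↦
    (Measure.measurePreserving_sub_left (volume : Measure (E d)) ξ).quasiMeasurePreserving
  -- Cauchy–Schwarz in `t` against the kernel, whose squared integral is at most `K²` for every `ξ`.
  -- Tonelli then separates `f` and `g`.
  have hpt : ∀ ξ, ‖(jw a ξ : ℂ) * conv F G ξ‖ₑ ^ 2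
      ≤ (K : ℝ≥0∞) ^ 2 * ∫⁻ t, f t ^ 2 * g (ξ - t) ^ 2 := by
    intro ξ
    have h1 : ‖(jw a ξ : ℂ) * conv F G ξ‖ₑ
        ≤ ∫⁻ t, (f t * g (ξ - t)) *
          ENNReal.ofReal (jw a ξ * (jw a t)⁻¹ * (m (ξ - t))⁻¹) := by
      rw [conv, ← integral_const_mul]
      refine (enorm_integral_le_lintegral_enorm _).trans (lintegral_mono_ae ?_)
      filter_upwards [(hqm ξ).ae hmh] with t ht
      have j1 := jw_pos a ξ
      have j2 := jw_pos a t
      have j3 := ht.1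
      simp only [hf, hg]
      rw [← ofReal_norm, ← ofReal_norm, ← ofReal_norm, ← ENNReal.ofReal_mul (norm_nonneg _),
        ← ENNReal.ofReal_mul (by positivity)]
      refine ENNReal.ofReal_le_ofReal (le_of_eq ?_)
      simp only [norm_mul, Complex.norm_real, Real.norm_eq_abs, abs_of_pos j1, abs_of_pos j2,
        abs_of_pos j3]
      field_simp
    have hgξ : AEMeasurable (fun t ↦ g (ξ - t)) volume := hgm.comp_quasiMeasurePreserving (hqm ξ)
    calc ‖(jw a ξ : ℂ) * conv F G ξ‖ₑ ^ 2
        ≤ (∫⁻ t, (f t * g (ξ - t)) *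
          ENNReal.ofReal (jw a ξ * (jw a t)⁻¹ * (m (ξ - t))⁻¹)) ^ 2 := by gcongr
      _ ≤ (∫⁻ t, (f t * g (ξ - t)) ^ 2) *
          ∫⁻ t, ENNReal.ofReal (jw a ξ * (jw a t)⁻¹ * (m (ξ - t))⁻¹) ^ 2 := by
        refine sq_lintegral_mul_le (hfm.mul hgξ) (Measurable.aemeasurable ?_)
        fun_prop
      _ ≤ (∫⁻ t, (f t * g (ξ - t)) ^ 2) * (K : ℝ≥0∞) ^ 2 := by gcongr; exact hK ξ
      _ = _ := by rw [mul_comm]; simp only [mul_pow]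
  have hG2 : AEMeasurable (fun p : E d × E d ↦ f p.2 ^ 2 * g (p.1 - p.2) ^ 2)
      (volume.prod volume) := by
    refine (hfm.comp_snd.pow_const 2).mul (AEMeasurable.pow_const ?_ 2)
    exact hgm.comp_quasiMeasurePreserving
      (quasiMeasurePreserving_sub_of_right_invariant volume volume)
  calc ∫⁻ ξ, ‖(jw a ξ : ℂ) * conv F G ξ‖ₑ ^ 2
      ≤ ∫⁻ ξ, (K : ℝ≥0∞) ^ 2 * ∫⁻ t, f t ^ 2 * g (ξ - t) ^ 2 := lintegral_mono hpt
    _ = (K : ℝ≥0∞) ^ 2 * ∫⁻ ξ, ∫⁻ t, f t ^ 2 * g (ξ - t) ^ 2 :=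
      lintegral_const_mul' _ _ (by finiteness)
    _ = (K : ℝ≥0∞) ^ 2 * ∫⁻ t, ∫⁻ ξ, f t ^ 2 * g (ξ - t) ^ 2 := by
      rw [lintegral_lintegral_swap hG2]
    _ = (K : ℝ≥0∞) ^ 2 * ∫⁻ t, f t ^ 2 * ∫⁻ ξ, g ξ ^ 2 := by
      congr 1
      refine lintegral_congr fun t ↦ ?_
      rw [lintegral_const_mul' _ _ (by simp only [hf]; finiteness),
        lintegral_sub_right_eq_self (fun ξ ↦ g ξ ^ 2) t]
    _ = (K : ℝ≥0∞) ^ 2 * (∫⁻ t, f t ^ 2) * ∫⁻ ξ, g ξ ^ 2 := by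
      rw [lintegral_mul_const'' _ (hfm.pow_const 2), mul_assoc]

/-- The kernel bound at `a = 0`, `ξ = 0` says that `1 / m` is square integrable, and Cauchy–Schwarz
concludes. -/
theorem Admissible.exists_lintegral_le {b : ℝ} {m : E d → ℝ} (hm : Admissible b m)
    (hb0 : 0 ≤ b) (hb : (d : ℝ) / 2 < b) :
    ∃ K : ℝ≥0, ∀ G : E d → ℂ, AEStronglyMeasurable G volume →
      ∫⁻ ξ, ‖G ξ‖ₑ ≤ K * wN m G := by
  obtain ⟨K, hK⟩ := hm.exists_kernel_bound le_rfl hb0 hb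
  refine ⟨K, fun G hG ↦ ?_⟩
  obtain ⟨h, hh, hh0, hmh⟩ := hm.bound
  have hmm := hm.measurable
  rw [← ENNReal.pow_le_pow_left_iff (two_ne_zero), mul_pow, wN_sq]
  have hK0 : ∫⁻ t, ENNReal.ofReal (m t)⁻¹ ^ 2 ≤ (K : ℝ≥0∞) ^ 2 := by
    refine le_trans (le_of_eq ?_) (hK 0)
    rw [← lintegral_sub_left_eq_self _ (0 : E d)]
    simp [jw]
  calc (∫⁻ ξ, ‖G ξ‖ₑ) ^ 2 = (∫⁻ ξ, ‖(m ξ : ℂ) * G ξ‖ₑ * ENNReal.ofReal (m ξ)⁻¹) ^ 2 := by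
        congr 1
        refine lintegral_congr_ae ?_
        filter_upwards [hmh] with ξ hξ
        rw [← ofReal_norm, ← ofReal_norm, ← ENNReal.ofReal_mul (norm_nonneg _)]
        congr 1
        rw [norm_mul, Complex.norm_real, Real.norm_eq_abs, abs_of_pos hξ.1]
        have := hξ.1
        field_simp
    _ ≤ (∫⁻ ξ, ‖(m ξ : ℂ) * G ξ‖ₑ ^ 2) * ∫⁻ ξ, ENNReal.ofReal (m ξ)⁻¹ ^ 2 := by
        refine sq_lintegral_mul_le ?_ (Measurable.aemeasurable (by fun_prop))
        exact ((Measurable.aestronglyMeasurable (by fun_prop)).mul hG).enorm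
    _ ≤ (∫⁻ ξ, ‖(m ξ : ℂ) * G ξ‖ₑ ^ 2) * (K : ℝ≥0∞) ^ 2 := by gcongr
    _ = _ := mul_comm _ _

open scoped Topology
open Filter

/-! ### Calculus of weighted bounds -/

/-- The weighted `L²` norm of `F` with weight `m` is at most `C`. -/
def BW (m : E d → ℝ) (F : E d → ℂ) (C : ℝ≥0) : Prop :=
  AEStronglyMeasurable F volume ∧ wN m F ≤ C

namespace BW

variable {m : E d → ℝ} {F G : E d → ℂ} {A B : ℝ≥0}

theorem mono (h : BW m F A) (hAB : A ≤ B) : BW m F B :=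
  ⟨h.1, h.2.trans (by exact_mod_cast hAB)⟩

theorem congr (h : BW m F A) (hFG : F =ᵐ[volume] G) : BW m G A := by
  refine ⟨h.1.congr hFG, le_trans (le_of_eq ?_) h.2⟩
  refine eLpNorm_congr_ae ?_
  filter_upwards [hFG] with ξ hξ
  rw [hξ]

theorem of_sum_le {ι : Type*} (s : Finset ι) {m' : ι → E d → ℝ} {F' : ι → E d → ℂ} {C : ι → ℝ≥0}
    (hF : AEStronglyMeasurable F volume) (hm : ∀ i ∈ s, Measurable (m' i))
    (h : ∀ i ∈ s, BW (m' i) (F' i) (C i))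
    (hle : ∀ᵐ ξ, ‖(m ξ : ℂ) * F ξ‖ ≤ ∑ i ∈ s, ‖(m' i ξ : ℂ) * F' i ξ‖) :
    BW m F (∑ i ∈ s, C i) := by
  refine ⟨hF, ?_⟩
  have hmeas : ∀ i ∈ s, AEStronglyMeasurable (fun ξ ↦ ‖(m' i ξ : ℂ) * F' i ξ‖) volume := by
    intro i hi
    have := hm i hi
    exact ((Measurable.aestronglyMeasurable (by fun_prop)).mul (h i hi).1).norm
  calc wN m F ≤ eLpNorm (∑ i ∈ s, fun ξ ↦ ‖(m' i ξ : ℂ) * F' i ξ‖) 2 volume := by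
        refine eLpNorm_mono_ae_real ?_
        filter_upwards [hle] with ξ hξ
        simpa [Finset.sum_apply] using hξ
    _ ≤ ∑ i ∈ s, eLpNorm (fun ξ ↦ ‖(m' i ξ : ℂ) * F' i ξ‖) 2 volume :=
        eLpNorm_sum_le hmeas (by norm_num)
    _ ≤ ∑ i ∈ s, (C i : ℝ≥0∞) := by
        refine Finset.sum_le_sum fun i hi ↦ ?_
        rw [eLpNorm_norm]
        exact (h i hi).2
    _ = _ := by push_cast; rfl

theorem of_le {m' : E d → ℝ} (h : BW m' G A) (hF : AEStronglyMeasurable F volume)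
    (hle : ∀ᵐ ξ, ‖(m ξ : ℂ) * F ξ‖ ≤ ‖(m' ξ : ℂ) * G ξ‖) : BW m F A := by
  refine ⟨hF, le_trans ?_ h.2⟩
  exact eLpNorm_mono_ae hle

theorem of_le_add {m₁ m₂ : E d → ℝ} {F₁ F₂ : E d → ℂ} (h₁ : BW m₁ F₁ A) (h₂ : BW m₂ F₂ B)
    (hF : AEStronglyMeasurable F volume) (hm₁ : Measurable m₁) (hm₂ : Measurable m₂)
    (hle : ∀ᵐ ξ, ‖(m ξ : ℂ) * F ξ‖ ≤ ‖(m₁ ξ : ℂ) * F₁ ξ‖ + ‖(m₂ ξ : ℂ) * F₂ ξ‖) :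
    BW m F (A + B) := by
  have := of_sum_le (m := m) (F := F) (Finset.univ : Finset Bool)
    (m' := fun b ↦ bif b then m₁ else m₂)
    (F' := fun b ↦ bif b then F₁ else F₂) (C := fun b ↦ bif b then A else B) hF
    (by rintro (_ | _) - <;> assumption) (by rintro (_ | _) - <;> assumption)
    (by simpa using hle)
  simpa using this

theorem add (h : BW m F A) (h' : BW m G B) (hm : Measurable m) : BW m (F + G) (A + B) :=
  of_le_add h h' (h.1.add h'.1) hm hm (.of_forall fun ξ ↦ by
    rw [Pi.add_apply, mul_add]; exact norm_add_le _ _)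

theorem sum {ι : Type*} (s : Finset ι) {F : ι → E d → ℂ} {C : ι → ℝ≥0}
    (h : ∀ i ∈ s, BW m (F i) (C i)) (hm : Measurable m) :
    BW m (∑ i ∈ s, F i) (∑ i ∈ s, C i) := by
  refine of_sum_le s (Finset.aestronglyMeasurable_sum _ fun i hi ↦ (h i hi).1)
    (fun _ _ ↦ hm) h (.of_forall fun ξ ↦ ?_)
  rw [Finset.sum_apply, Finset.mul_sum]
  exact norm_sum_le _ _

theorem smul (h : BW m F A) (c : ℂ) : BW m (c • F) (‖c‖₊ * A) := by
  refine ⟨h.1.const_smul c, ?_⟩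
  have : (fun ξ ↦ (m ξ : ℂ) * (c • F) ξ) = c • fun ξ ↦ (m ξ : ℂ) * F ξ := by
    ext ξ; simp only [Pi.smul_apply, smul_eq_mul]; ring
  rw [wN, this, eLpNorm_const_smul, ENNReal.coe_mul]
  exact mul_le_mul' le_rfl h.2

theorem neg (h : BW m F A) : BW m (-F) A := by
  simpa using h.smul (-1)

theorem sub (h : BW m F A) (h' : BW m G B) (hm : Measurable m) : BW m (F - G) (A + B) := by
  rw [sub_eq_add_neg]; exact h.add h'.neg hm

theorem ofReal_norm (h : BW m F A) : BW m (fun ξ ↦ (‖F ξ‖ : ℂ)) A := by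
  refine ⟨Complex.continuous_ofReal.comp_aestronglyMeasurable h.1.norm, le_trans (le_of_eq ?_) h.2⟩
  refine eLpNorm_congr_norm_ae (.of_forall fun ξ ↦ ?_)
  simp

theorem mul_jw {a b c : ℝ} (h : BW (jw c) F A) (habc : a + b = c) :
    BW (jw a) (fun ξ ↦ (jw b ξ : ℂ) * F ξ) A := by
  refine ⟨(Measurable.aestronglyMeasurable (by fun_prop)).mul h.1, le_trans (le_of_eq ?_) h.2⟩
  refine eLpNorm_congr_ae (.of_forall fun ξ ↦ ?_)
  simp only
  rw [← mul_assoc, ← Complex.ofReal_mul, jw_eq, jw_eq, jw_eq, ← Real.rpow_add (jap_pos ξ), ← habc]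
  congr 3
  ring

theorem jw_le {a b : ℝ} (hab : a ≤ b) (ξ : E d) : jw a ξ ≤ jw b ξ :=
  Real.rpow_le_rpow_of_exponent_le (one_le_jap ξ) (by linarith)

theorem anti {a b : ℝ} (h : BW (jw b) F A) (hab : a ≤ b) : BW (jw a) F A := by
  refine h.of_le h.1 (.of_forall fun ξ ↦ ?_)
  simp only [norm_mul, Complex.norm_real, Real.norm_eq_abs, abs_of_pos (jw_pos _ ξ)]
  gcongr
  exact jw_le hab ξ

theorem memLp_mul (h : BW m F A) (hm : Measurable m) :
    MemLp (fun ξ ↦ (m ξ : ℂ) * F ξ) 2 volume :=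
  ⟨(Measurable.aestronglyMeasurable (by fun_prop)).mul h.1, h.2.trans_lt ENNReal.coe_lt_top⟩

theorem memLp {a : ℝ} (h : BW (jw a) F A) (ha : 0 ≤ a) : MemLp F 2 volume := by
  have := (h.anti ha).memLp_mul (by fun_prop)
  simpa [jw] using this

theorem of_memLp (hm : Measurable m) (hm0 : ∀ ξ, m ξ ≠ 0)
    (h : MemLp (fun ξ ↦ (m ξ : ℂ) * F ξ) 2 volume) : BW m F (wN m F).toNNReal := by
  refine ⟨?_, le_of_eq (ENNReal.coe_toNNReal h.2.ne).symm⟩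
  have : F = fun ξ ↦ ((m ξ)⁻¹ : ℂ) * ((m ξ : ℂ) * F ξ) := by
    ext ξ
    rw [inv_mul_cancel_left₀ (by exact_mod_cast hm0 ξ)]
  rw [this]
  exact (Measurable.aestronglyMeasurable (by fun_prop)).mul h.1

/-- Weighted `L²` bounds are stable under `L²` limits. -/
theorem of_tendsto {S : ℕ → E d → ℂ} (h : ∀ n, BW m (S n) A)
    (hF : AEStronglyMeasurable F volume) (hm : Measurable m)
    (hlim : Tendsto (fun n ↦ eLpNorm (S n - F) 2 volume) atTop (𝓝 0)) : BW m F A := by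
  -- `L²` convergence gives an almost everywhere convergent subsequence, to which Fatou's lemma
  -- applies.
  have h1 := tendstoInMeasure_of_tendsto_eLpNorm (by norm_num) (fun n ↦ (h n).1) hF hlim
  obtain ⟨ns, -, hns⟩ := h1.exists_seq_tendsto_ae
  refine ⟨hF, ?_⟩
  have h2 := Lp.eLpNorm_lim_le_liminf_eLpNorm (p := 2) (μ := (volume : Measure (E d)))
    (f := fun n ξ ↦ (m ξ : ℂ) * S (ns n) ξ)
    (fun n ↦ (Measurable.aestronglyMeasurable (by fun_prop)).mul (h (ns n)).1)
    (fun ξ ↦ (m ξ : ℂ) * F ξ) (by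
      filter_upwards [hns] with ξ hξ
      exact hξ.const_mul _)
  refine h2.trans ?_
  refine (Filter.liminf_le_liminf (.of_forall fun n ↦ (h (ns n)).2)).trans ?_
  simp

end BW

/-! ### Product estimates in Sobolev spaces -/

theorem conv_comm (F G : E d → ℂ) : conv F G = conv G F := by
  ext ξ
  rw [conv, conv, ← integral_sub_left_eq_self _ volume ξ]
  simp [mul_comm]

theorem Admissible.exists_conv {a b : ℝ} {m : E d → ℝ} (hm : Admissible b m) (ha : 0 ≤ a)
    (hab : a ≤ b) (hb : (d : ℝ) / 2 < b) :
    ∃ K : ℝ≥0, ∀ (F G : E d → ℂ) (A B : ℝ≥0), BW (jw a) F A → BW m G B →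
      BW (jw a) (conv F G) (K * A * B) := by
  obtain ⟨K, hK⟩ := hm.exists_wN_conv_le ha hab hb
  refine ⟨K, fun F G A B hF hG ↦ ⟨aestronglyMeasurable_conv hF.1 hG.1,
    (hK F G hF.1 hG.1).trans ?_⟩⟩
  push_cast
  gcongr
  exacts [hF.2, hG.2]

theorem Admissible.exists_integral_le {b : ℝ} {m : E d → ℝ} (hm : Admissible b m)
    (hb : (d : ℝ) / 2 < b) :
    ∃ K : ℝ≥0, ∀ (G : E d → ℂ) (B : ℝ≥0), BW m G B → Integrable G ∧ ∫ ξ, ‖G ξ‖ ≤ K * B := by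
  have hb0 : 0 ≤ b := le_trans (by positivity) hb.le
  obtain ⟨K, hK⟩ := hm.exists_lintegral_le hb0 hb
  refine ⟨K, fun G B hG ↦ ?_⟩
  have h1 : ∫⁻ ξ, ‖G ξ‖ₑ ≤ (K * B : ℝ≥0) := by
    refine (hK G hG.1).trans ?_
    push_cast
    gcongr
    exact hG.2
  have hi : Integrable G := ⟨hG.1, h1.trans_lt ENNReal.coe_lt_top⟩
  refine ⟨hi, ?_⟩
  rw [integral_norm_eq_lintegral_enorm hG.1]
  exact ENNReal.toReal_le_of_le_ofReal (by positivity) (h1.trans (by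
    rw [← ENNReal.ofReal_coe_nnreal]; push_cast; rfl))

theorem BW.integrable {b : ℝ} {m : E d → ℝ} {G : E d → ℂ} {B : ℝ≥0} (h : BW m G B)
    (hm : Admissible b m) (hb : (d : ℝ) / 2 < b) : Integrable G := by
  obtain ⟨K, hK⟩ := hm.exists_integral_le hb
  exact (hK G B h).1

theorem ae_integrable_conv {F G : E d → ℂ} (hF : Integrable F) (hG : Integrable G) :
    ∀ᵐ ξ, Integrable fun t ↦ F t * G (ξ - t) :=
  hF.ae_convolution_exists (ContinuousLinearMap.mul ℝ ℂ) hG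

/-- The product rule on the Fourier side. -/
theorem dSymbol_mul_conv {F G : E d → ℂ} (i : Fin d) (hF : Integrable F) (hG : Integrable G)
    (hF' : Integrable fun ξ ↦ dSymbol i ξ * F ξ) (hG' : Integrable fun ξ ↦ dSymbol i ξ * G ξ) :
    (fun ξ ↦ dSymbol i ξ * conv F G ξ) =ᵐ[volume]
      conv (fun ξ ↦ dSymbol i ξ * F ξ) G + conv F fun ξ ↦ dSymbol i ξ * G ξ := by
  filter_upwards [ae_integrable_conv hF' hG, ae_integrable_conv hF hG'] with ξ h1 h2
  rw [Pi.add_apply, conv, conv, conv, ← integral_add h1 h2, ← integral_const_mul]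
  refine integral_congr_ae (.of_forall fun t ↦ ?_)
  simp only [dSymbol, PiLp.sub_apply]
  push_cast
  ring

theorem conv_ofReal_norm (f g : E d → ℝ) (ξ : E d) :
    conv (fun t ↦ (f t : ℂ)) (fun t ↦ (g t : ℂ)) ξ = ((∫ t, f t * g (ξ - t) : ℝ) : ℂ) := by
  rw [conv, ← integral_complex_ofReal]
  simp

theorem jw_one_le (ξ t : E d) : jw 1 ξ ≤ 2 * (jw 1 t + jw 1 (ξ - t)) := by
  have h := jap_le_four_mul_max ξ t
  have h1 := jap_pos t
  have h2 := jap_pos (ξ - t)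
  simp only [jw_eq, ← Real.sqrt_eq_rpow]
  rw [Real.sqrt_le_left (by positivity)]
  have e1 := Real.sq_sqrt h1.le
  have e2 := Real.sq_sqrt h2.le
  have p1 := Real.sqrt_nonneg (jap t)
  have p2 := Real.sqrt_nonneg (jap (ξ - t))
  rcases max_cases (jap t) (jap (ξ - t)) with ⟨h3, -⟩ | ⟨h3, -⟩ <;> rw [h3] at h <;> nlinarith

/-- A Leibniz rule as an inequality: one order of weight falls on one factor or the other. Absolute
values are needed since the weight is not additive. -/
theorem jw_one_mul_conv_le {F G : E d → ℂ} (hF : Integrable F) (hG : Integrable G)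
    (hF' : Integrable fun ξ ↦ (jw 1 ξ : ℂ) * F ξ) (hG' : Integrable fun ξ ↦ (jw 1 ξ : ℂ) * G ξ) :
    ∀ᵐ ξ, jw 1 ξ * ‖conv F G ξ‖ ≤
      2 * (‖conv (fun t ↦ (‖(jw 1 t : ℂ) * F t‖ : ℂ)) (fun t ↦ (‖G t‖ : ℂ)) ξ‖ +
        ‖conv (fun t ↦ (‖F t‖ : ℂ)) (fun t ↦ (‖(jw 1 t : ℂ) * G t‖ : ℂ)) ξ‖) := by
  filter_upwards [ae_integrable_conv hF' hG, ae_integrable_conv hF hG'] with ξ h1 h2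
  have h1' := h1.norm
  have h2' := h2.norm
  simp only [norm_mul] at h1' h2'
  simp only [conv_ofReal_norm, Complex.norm_real, Real.norm_eq_abs]
  simp only [norm_mul]
  rw [abs_of_nonneg (integral_nonneg fun t ↦ by positivity),
    abs_of_nonneg (integral_nonneg fun t ↦ by positivity), ← integral_add h1' h2',
    ← integral_const_mul]
  calc jw 1 ξ * ‖conv F G ξ‖ = ‖∫ t, (jw 1 ξ : ℂ) * (F t * G (ξ - t))‖ := by
        rw [integral_const_mul, norm_mul, Complex.norm_real, Real.norm_eq_abs,
          abs_of_pos (jw_pos _ ξ), conv]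
    _ ≤ _ := by
        refine norm_integral_le_of_norm_le ((h1'.add h2').const_mul 2) (.of_forall fun t ↦ ?_)
        have := jw_one_le ξ t
        have j1 := jw_pos 1 ξ
        have j2 := jw_pos 1 t
        have j3 := jw_pos 1 (ξ - t)
        simp only [norm_mul, Complex.norm_real, Real.norm_eq_abs, abs_of_pos j1,
          abs_of_pos j2, abs_of_pos j3]
        calc jw 1 ξ * (‖F t‖ * ‖G (ξ - t)‖)
            ≤ (2 * (jw 1 t + jw 1 (ξ - t))) * (‖F t‖ * ‖G (ξ - t)‖) := by gcongr
          _ = _ := by ring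

/-- The tame estimate in `H^{t+1}`. -/
theorem exists_conv_tame {t : ℝ} (ht : (d : ℝ) / 2 < t) :
    ∃ K : ℝ≥0, ∀ (F G : E d → ℂ) (A B A' B' : ℝ≥0), BW (jw t) F A → BW (jw t) G B →
      BW (jw (t + 1)) F A' → BW (jw (t + 1)) G B' →
      BW (jw t) (conv F G) (K * A * B) ∧
      BW (jw (t + 1)) (conv F G) (K * (A' * B + A * B')) := by
  have ht0 : 0 ≤ t := le_trans (by positivity) ht.le
  obtain ⟨K, hK⟩ := (admissible_jw (d := d) t).exists_conv ht0 le_rfl ht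
  refine ⟨2 * K, fun F G A B A' B' hF hG hF' hG' ↦
    ⟨(hK F G A B hF hG).mono (by gcongr; exact le_mul_of_one_le_left' one_le_two), ?_⟩⟩
  have hF1 := hF'.mul_jw (a := t) (b := 1) rfl
  have hG1 := hG'.mul_jw (a := t) (b := 1) rfl
  have hadm := admissible_jw (d := d) t
  have k1 := (hK _ _ _ _ hF1.ofReal_norm hG.ofReal_norm).smul 2
  have k2 := (hK _ _ _ _ hF.ofReal_norm hG1.ofReal_norm).smul 2
  have := BW.of_le_add (m := jw (t + 1)) (F := conv F G) k1 k2
    (aestronglyMeasurable_conv hF.1 hG.1) (by fun_prop) (by fun_prop) ?_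
  · refine this.mono (le_of_eq ?_)
    have h2 : ‖(2 : ℂ)‖₊ = 2 := by ext; simp
    rw [h2]
    ring
  filter_upwards [jw_one_mul_conv_le (hF.integrable hadm ht) (hG.integrable hadm ht)
    (hF1.integrable hadm ht) (hG1.integrable hadm ht)] with ξ hξ
  have hj : jw (t + 1) ξ = jw t ξ * jw 1 ξ := by
    rw [jw_eq, jw_eq, jw_eq, ← Real.rpow_add (jap_pos ξ)]; ring_nf
  rw [norm_mul, norm_mul, norm_mul, Complex.norm_real, Complex.norm_real, Real.norm_eq_abs,
    Real.norm_eq_abs, abs_of_pos (jw_pos _ ξ), abs_of_pos (jw_pos _ ξ), hj, mul_assoc, ← mul_add]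
  refine mul_le_mul_of_nonneg_left (hξ.trans (le_of_eq ?_)) (jw_pos _ ξ).le
  simp only [Pi.smul_apply, norm_smul]
  norm_num
  ring

/-! ### The exponential of a Sobolev function -/

/-- The Fourier transform of `f ^ (n + 1)`, as an iterated convolution of that of `f`. -/
def convPow (F : E d → ℂ) : ℕ → E d → ℂ
  | 0 => F
  | n + 1 => conv F (convPow F n)

theorem sum_pow_div_le (x : ℝ≥0) (N : ℕ) :
    ∑ n ∈ Finset.range N, x ^ n / (n.factorial : ℝ≥0) ≤ Real.toNNReal (Real.exp x) := by
  rw [← NNReal.coe_le_coe, Real.coe_toNNReal _ (Real.exp_pos _).le]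
  push_cast
  exact Real.sum_le_exp_of_nonneg x.2 N

theorem nnnorm_inv_factorial (n : ℕ) : ‖((n.factorial : ℂ))⁻¹‖₊ = (n.factorial : ℝ≥0)⁻¹ := by
  ext; simp

/-- Index `n` is the power `n + 1`. The extra order of weight falls on one of the `n + 1` factors,
so `R'` enters linearly; the loss `n + 1` is compensated by `(n + 1)!` in the exponential series. -/
theorem convPow_bounds {t : ℝ} {K : ℝ≥0}
    (hK : ∀ (F G : E d → ℂ) (A B A' B' : ℝ≥0), BW (jw t) F A → BW (jw t) G B →
      BW (jw (t + 1)) F A' → BW (jw (t + 1)) G B' →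
      BW (jw t) (conv F G) (K * A * B) ∧
      BW (jw (t + 1)) (conv F G) (K * (A' * B + A * B'))) {Φ : E d → ℂ} {R R' : ℝ≥0}
    (h : BW (jw t) Φ R) (h' : BW (jw (t + 1)) Φ R') (n : ℕ) :
    BW (jw t) (convPow Φ n) ((K * R) ^ n * R) ∧
      BW (jw (t + 1)) (convPow Φ n) ((n + 1 : ℕ) * (K * R) ^ n * R') := by
  induction n with
  | zero => exact ⟨h.mono (by simp), h'.mono (by simp)⟩
  | succ n ih =>
    obtain ⟨h1, h2⟩ := hK _ _ _ _ _ _ h ih.1 h' ih.2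
    refine ⟨h1.mono (le_of_eq (by ring)), h2.mono (le_of_eq ?_)⟩
    push_cast
    ring

theorem IsFT.convPow {f Φ : E d → ℂ} (h : IsFT f Φ) (hi : Integrable Φ)
    (hm : ∀ n, MemLp (convPow Φ n) 2 volume) (n : ℕ) :
    IsFT (fun x ↦ f x ^ (n + 1)) (convPow Φ n) := by
  induction n with
  | zero => simpa [WeightedFriedrichs.convPow] using h
  | succ n ih =>
    refine (h.mul ih hi (hm (n + 1))).congr (.of_forall fun x ↦ ?_) (.of_forall fun ξ ↦ rfl)
    simp only [Pi.mul_apply]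
    ring

/-- Partial sums of the exponential series converge in `L²`. -/
theorem tendsto_exp_partialSum {φ : E d → ℝ} {M : ℝ} (hφ : MemLp (fun x ↦ (φ x : ℂ)) 2 volume)
    (hM : ∀ᵐ x, |φ x| ≤ M) :
    Tendsto (fun N : ℕ ↦ eLpNorm ((∑ n ∈ Finset.range N,
        ((n + 1).factorial : ℂ)⁻¹ • fun x ↦ (φ x : ℂ) ^ (n + 1)) -
        fun x ↦ ((Real.exp (φ x) - 1 : ℝ) : ℂ)) 2 volume) atTop (𝓝 0) := by
  set D : ℕ → E d → ℂ := fun N ↦ (∑ n ∈ Finset.range N,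
        ((n + 1).factorial : ℂ)⁻¹ • fun x ↦ (φ x : ℂ) ^ (n + 1)) -
        fun x ↦ ((Real.exp (φ x) - 1 : ℝ) : ℂ) with hD
  have hform : ∀ N x, D N x = -(Complex.exp (φ x) -
      ∑ n ∈ Finset.range (N + 1), (φ x : ℂ) ^ n / n.factorial) := by
    intro N x
    rw [Finset.sum_range_succ']
    simp only [hD, Pi.sub_apply, Finset.sum_apply, Pi.smul_apply, smul_eq_mul]
    push_cast
    simp only [pow_zero, Nat.factorial_zero, Nat.cast_one, div_one]
    rw [neg_sub, add_sub_right_comm, sub_sub_eq_add_sub, add_sub_right_comm]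
    congr 2
    refine Finset.sum_congr rfl fun n _ ↦ ?_
    rw [mul_comm, div_eq_mul_inv]
  -- The remainder is at most `e^{|φ|} - 1 ≤ |φ| e^{|φ|}`, which is dominated in `L²` because `φ` is
  -- bounded.
  have hbound : ∀ N x, ‖D N x‖ ≤ |φ x| * Real.exp |φ x| := by
    intro N x
    have h1 := Complex.norm_exp_sub_sum_le_exp_norm_sub_sum (φ x) (N + 1)
    have h2 : (1 : ℝ) ≤ ∑ n ∈ Finset.range (N + 1), ‖(φ x : ℂ)‖ ^ n / n.factorial := by
      rw [Finset.sum_range_succ']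
      have : 0 ≤ ∑ n ∈ Finset.range N, ‖(φ x : ℂ)‖ ^ (n + 1) / (n + 1).factorial :=
        Finset.sum_nonneg fun _ _ ↦ by positivity
      simp only [pow_zero, Nat.factorial_zero, Nat.cast_one, div_one]
      linarith
    have h3 := Complex.norm_exp_sub_sum_le_norm_mul_exp ((|φ x| : ℝ) : ℂ) 1
    simp only [Finset.range_one, Finset.sum_singleton, pow_zero, Nat.factorial_zero, Nat.cast_one,
      div_one, pow_one, Complex.norm_real, Real.norm_eq_abs, abs_abs] at h3
    rw [← Complex.ofReal_exp, ← Complex.ofReal_one, ← Complex.ofReal_sub, Complex.norm_real,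
      Real.norm_eq_abs] at h3
    rw [hform, norm_neg]
    refine (h1.trans ?_).trans h3
    rw [Complex.norm_real, Real.norm_eq_abs] at *
    exact le_trans (by linarith) (le_abs_self _)
  have hlim : ∀ x, Tendsto (fun N ↦ D N x) atTop (𝓝 0) := by
    intro x
    have h1 := (NormedSpace.expSeries_div_hasSum_exp (φ x : ℂ)).tendsto_sum_nat
    rw [← Complex.exp_eq_exp_ℂ] at h1
    have h2 := ((tendsto_add_atTop_iff_nat 1).2 h1).const_sub (Complex.exp (φ x))
    rw [sub_self] at h2
    simpa [hform] using h2.neg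
  have hφm : AEMeasurable φ volume := by
    have := Complex.measurable_re.comp_aemeasurable hφ.1.aemeasurable
    simpa [Function.comp_def] using this
  have hDm : ∀ N, AEStronglyMeasurable (D N) volume := by
    intro N
    have : D N = fun x ↦ -(Complex.exp (φ x) -
      ∑ n ∈ Finset.range (N + 1), (φ x : ℂ) ^ n / n.factorial) := funext (hform N)
    rw [this]
    exact AEMeasurable.aestronglyMeasurable (by fun_prop)
  have hsq : Tendsto (fun N ↦ ∫⁻ x, ‖D N x‖ₑ ^ (2 : ℝ)) atTop (𝓝 (∫⁻ _ : E d, 0)) := by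
    refine tendsto_lintegral_of_dominated_convergence'
      (fun x ↦ ‖(Real.exp M : ℂ) * (φ x : ℂ)‖ₑ ^ (2 : ℝ))
      (fun N ↦ (hDm N).enorm.pow_const _) (fun N ↦ ?_) ?_ (.of_forall fun x ↦ ?_)
    · filter_upwards [hM] with x hx
      gcongr
      rw [enorm_le_iff_norm_le, norm_mul, Complex.norm_real, Complex.norm_real, Real.norm_eq_abs,
        Real.norm_eq_abs, abs_of_pos (Real.exp_pos _), mul_comm]
      refine (hbound N x).trans ?_
      gcongr
    · exact ((hφ.const_mul _).eLpNorm_lt_top.ne |> fun h ↦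
        (lintegral_rpow_enorm_lt_top_of_eLpNorm_lt_top (by norm_num) (by norm_num)
          (lt_top_iff_ne_top.2 h)).ne)
    · have h1 := (hlim x).enorm
      rw [enorm_zero] at h1
      have := h1.ennrpow_const 2
      simpa using this
  rw [lintegral_zero] at hsq
  have := hsq.ennrpow_const (1 / 2)
  have e : ∀ N, (∫⁻ x, ‖D N x‖ₑ ^ (2 : ℝ)) ^ (1 / 2 : ℝ) = eLpNorm (D N) 2 volume := by
    intro N
    rw [eLpNorm_eq_lintegral_rpow_enorm_toReal (by norm_num) (by norm_num)]
    simp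
  have h := this.congr e
  rwa [ENNReal.zero_rpow_of_pos (by norm_num)] at h

/-- Composition with the exponential function in Sobolev spaces, with tame bounds. -/
theorem exists_exp_sub_one {t : ℝ} (ht : (d : ℝ) / 2 < t) (R : ℝ≥0) :
    ∃ C M : ℝ≥0, ∀ (φ : E d → ℝ) (Φ : E d → ℂ) (R' : ℝ≥0), IsFT (fun x ↦ (φ x : ℂ)) Φ →
      BW (jw t) Φ R → BW (jw (t + 1)) Φ R' → (∀ᵐ x, |φ x| ≤ M) ∧
      ∃ B, IsFT (fun x ↦ ((Real.exp (φ x) - 1 : ℝ) : ℂ)) B ∧ BW (jw t) B C ∧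
        BW (jw (t + 1)) B (C * R') := by
  have ht0 : 0 ≤ t := le_trans (by positivity) ht.le
  obtain ⟨K, hK⟩ := exists_conv_tame (d := d) ht
  obtain ⟨L, hL⟩ := (admissible_jw (d := d) t).exists_integral_le ht
  set x : ℝ≥0 := K * R with hx
  set c : ℝ≥0 := Real.toNNReal (Real.exp x) with hc
  -- The two series are bounded by `c * R` and `c * R'`; `(R + 1) * c` serves both.
  refine ⟨(R + 1) * c, L * R, fun φ Φ R' hφ hR hR' ↦ ?_⟩
  obtain ⟨hint, hL1⟩ := hL Φ R hR
  have hbd := convPow_bounds hK hR hR'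
  have hpow := hφ.convPow hint fun n ↦ (hbd n).1.memLp ht0
  have hM : ∀ᵐ x, |φ x| ≤ (L * R : ℝ≥0) := by
    filter_upwards [hφ.norm_le_integral hint] with y hy
    rw [Complex.norm_real, Real.norm_eq_abs] at hy
    exact hy.trans (by push_cast; exact hL1)
  refine ⟨hM, ?_⟩
  have hconv := tendsto_exp_partialSum hφ.memLp hM
  set S : ℕ → E d → ℂ := fun N ↦ ∑ n ∈ Finset.range N, ((n + 1).factorial : ℂ)⁻¹ • convPow Φ n
  set f : ℕ → E d → ℂ := fun N ↦ ∑ n ∈ Finset.range N,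
    ((n + 1).factorial : ℂ)⁻¹ • fun x ↦ (φ x : ℂ) ^ (n + 1)
  have hS : ∀ N, IsFT (f N) (S N) := fun N ↦ IsFT.sum _ fun n _ ↦ (hpow n).smul _
  have hlimLp : MemLp (fun x ↦ ((Real.exp (φ x) - 1 : ℝ) : ℂ)) 2 volume := by
    have h1 : AEMeasurable φ volume := by
      have := Complex.measurable_re.comp_aemeasurable hφ.memLp.1.aemeasurable
      simpa [Function.comp_def] using this
    have h2 : AEStronglyMeasurable (fun x ↦ ((Real.exp (φ x) - 1 : ℝ) : ℂ)) volume :=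
      AEMeasurable.aestronglyMeasurable (by fun_prop)
    -- One partial sum at finite `L²` distance suffices for the limit to be square integrable.
    have h3 : ∀ᶠ N in atTop, eLpNorm (f N - fun x ↦ ((Real.exp (φ x) - 1 : ℝ) : ℂ)) 2 volume < 1 :=
      hconv.eventually_lt_const (by norm_num)
    obtain ⟨N, hN⟩ := h3.exists
    have h4 : MemLp (f N - fun x ↦ ((Real.exp (φ x) - 1 : ℝ) : ℂ)) 2 volume :=
      ⟨(hS N).memLp.1.sub h2, hN.trans ENNReal.one_lt_top⟩
    simpa using (hS N).memLp.sub h4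
  obtain ⟨B, hB⟩ := IsFT.exists_fourier hlimLp
  have hlimB : Tendsto (fun N ↦ eLpNorm (S N - B) 2 volume) atTop (𝓝 0) := by
    refine hconv.congr fun N ↦ ?_
    exact ((hS N).sub hB).eLpNorm_eq
  refine ⟨B, hB, BW.of_tendsto (S := S) (fun N ↦ ?_) hB.memLp'.1 (by fun_prop) hlimB,
    BW.of_tendsto (S := S) (fun N ↦ ?_) hB.memLp'.1 (by fun_prop) hlimB⟩
  · refine (BW.sum _ (fun n _ ↦ (hbd n).1.smul _) (by fun_prop)).mono ?_
    calc ∑ n ∈ Finset.range N, ‖((n + 1).factorial : ℂ)⁻¹‖₊ * (x ^ n * R)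
        ≤ ∑ n ∈ Finset.range N, x ^ n / (n.factorial : ℝ≥0) * R := by
          refine Finset.sum_le_sum fun n _ ↦ ?_
          rw [nnnorm_inv_factorial, ← mul_assoc, div_eq_inv_mul]
          gcongr
          exact Nat.le_succ n
      _ = (∑ n ∈ Finset.range N, x ^ n / (n.factorial : ℝ≥0)) * R := by rw [Finset.sum_mul]
      _ ≤ c * R := by gcongr; exact sum_pow_div_le x N
      _ ≤ (R + 1) * c := by rw [mul_comm]; gcongr; exact le_self_add
  · refine (BW.sum _ (fun n _ ↦ (hbd n).2.smul _) (by fun_prop)).mono ?_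
    calc ∑ n ∈ Finset.range N, ‖((n + 1).factorial : ℂ)⁻¹‖₊ * ((n + 1 : ℕ) * x ^ n * R')
        = ∑ n ∈ Finset.range N, x ^ n / (n.factorial : ℝ≥0) * R' := by
          refine Finset.sum_congr rfl fun n _ ↦ ?_
          rw [nnnorm_inv_factorial, Nat.factorial_succ]
          push_cast
          field_simp
      _ = (∑ n ∈ Finset.range N, x ^ n / (n.factorial : ℝ≥0)) * R' := by rw [Finset.sum_mul]
      _ ≤ c * R' := by gcongr; exact sum_pow_div_le x N
      _ ≤ (R + 1) * c * R' := by gcongr; exact le_mul_of_one_le_left' le_add_self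

/-! ### Divergence and curl on the Fourier side -/

theorem norm_dSymbol (i : Fin d) (ξ : E d) : ‖dSymbol i ξ‖ = |2 * Real.pi * ξ i| := by
  simp [dSymbol, abs_mul]

theorem norm_dSymbol_le (i : Fin d) (ξ : E d) : ‖dSymbol i ξ‖ ≤ ‖(2 * Real.pi) • ξ‖ := by
  rw [norm_dSymbol]
  simpa using PiLp.norm_apply_le ((2 * Real.pi) • ξ) i

theorem sum_dSymbol_sq (ξ : E d) :
    ∑ i, dSymbol i ξ * dSymbol i ξ = -((‖(2 * Real.pi) • ξ‖ ^ 2 : ℝ) : ℂ) := by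
  rw [EuclideanSpace.norm_sq_eq]
  push_cast
  rw [← Finset.sum_neg_distrib]
  refine Finset.sum_congr rfl fun i _ ↦ ?_
  simp only [PiLp.smul_apply, smul_eq_mul, Real.norm_eq_abs, dSymbol]
  rw [← Complex.ofReal_pow, sq_abs]
  push_cast
  linear_combination (4 * (Real.pi : ℂ) ^ 2 * (ξ i : ℂ) ^ 2) * Complex.I_sq

theorem conj_dSymbol (i : Fin d) (ξ : E d) : (starRingEnd ℂ) (dSymbol i ξ) = -dSymbol i ξ := by
  simp [dSymbol, Complex.conj_ofNat]

@[fun_prop]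
theorem continuous_dSymbol (i : Fin d) : Continuous (dSymbol i : E d → ℂ) := by
  unfold dSymbol; fun_prop

/-- A vector is controlled by its divergence and its curl, on the Fourier side. -/
theorem norm_mul_le_div_add_curl (X : Fin d → ℂ) (ξ : E d) (j : Fin d) :
    ‖(2 * Real.pi) • ξ‖ * ‖X j‖ ≤ ‖∑ k, dSymbol k ξ * X k‖ +
      ∑ i, ‖dSymbol i ξ * X j - dSymbol j ξ * X i‖ := by
  set n := ‖(2 * Real.pi) • ξ‖ with hn
  have hn0 : 0 ≤ n := norm_nonneg _
  rcases hn0.eq_or_lt with h0 | h0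
  · rw [← h0, zero_mul]; positivity
  refine le_of_mul_le_mul_left ?_ h0
  -- The symbol form of `-Δ X_j = -∂_j div X - ∑ ∂_i (∂_i X_j - ∂_j X_i)`.
  have key : ((n ^ 2 : ℝ) : ℂ) * X j = -(dSymbol j ξ * ∑ k, dSymbol k ξ * X k) -
      ∑ i, dSymbol i ξ * (dSymbol i ξ * X j - dSymbol j ξ * X i) := by
    simp only [mul_sub, Finset.sum_sub_distrib, ← mul_assoc, ← Finset.sum_mul]
    rw [sum_dSymbol_sq, Finset.mul_sum, ← hn]
    have : ∑ i, dSymbol j ξ * (dSymbol i ξ * X i) = ∑ i, dSymbol i ξ * dSymbol j ξ * X i :=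
      Finset.sum_congr rfl fun i _ ↦ by ring
    rw [this]; ring
  calc n * (n * ‖X j‖) = ‖((n ^ 2 : ℝ) : ℂ) * X j‖ := by
        rw [norm_mul, Complex.norm_real, Real.norm_eq_abs, abs_of_nonneg (by positivity)]; ring
    _ ≤ ‖dSymbol j ξ‖ * ‖∑ k, dSymbol k ξ * X k‖ +
        ∑ i, ‖dSymbol i ξ‖ * ‖dSymbol i ξ * X j - dSymbol j ξ * X i‖ := by
        rw [key]
        refine (norm_sub_le _ _).trans ?_
        rw [norm_neg, norm_mul]
        gcongr
        refine (norm_sum_le _ _).trans (le_of_eq ?_)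
        simp only [norm_mul]
    _ ≤ n * ‖∑ k, dSymbol k ξ * X k‖ +
        ∑ i, n * ‖dSymbol i ξ * X j - dSymbol j ξ * X i‖ := by
        gcongr <;> exact norm_dSymbol_le _ _
    _ = _ := by rw [mul_add, Finset.mul_sum]

/-- Multiplication by the symbol of `∂_i`. -/
def dMul (i : Fin d) (F : E d → ℂ) (ξ : E d) : ℂ := dSymbol i ξ * F ξ

theorem aestronglyMeasurable_dMul {F : E d → ℂ} (hF : AEStronglyMeasurable F volume) (i : Fin d) :
    AEStronglyMeasurable (dMul i F) volume :=
  (continuous_dSymbol i).aestronglyMeasurable.mul hF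

theorem norm_jw_mul (b : ℝ) (ξ : E d) (z : ℂ) : ‖(jw b ξ : ℂ) * z‖ = jw b ξ * ‖z‖ := by
  rw [norm_mul, Complex.norm_real, Real.norm_eq_abs, abs_of_pos (jw_pos _ _)]

theorem norm_hw_mul (b : ℝ) (ξ : E d) (z : ℂ) :
    ‖(hw b ξ : ℂ) * z‖ = jw b ξ * (‖(2 * Real.pi) • ξ‖ * ‖z‖) := by
  rw [norm_mul, Complex.norm_real, Real.norm_eq_abs, abs_of_nonneg (hw_nonneg _ _), hw]
  ring

theorem hw_le_jw (b : ℝ) (ξ : E d) : hw b ξ ≤ jw (b + 1) ξ := by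
  have : jw (b + 1) ξ = Real.sqrt (jap ξ) * jw b ξ := by
    rw [jw_eq, jw_eq, Real.sqrt_eq_rpow, ← Real.rpow_add (jap_pos ξ)]; ring_nf
  rw [hw, this]
  have := jw_pos b ξ
  gcongr
  refine Real.le_sqrt_of_sq_le ?_
  unfold jap; linarith

namespace BW

variable {F G : E d → ℂ} {A B : ℝ≥0} {b : ℝ}

theorem hw_of_jw (h : BW (jw (b + 1)) F A) : BW (hw b) F A := by
  refine h.of_le h.1 (.of_forall fun ξ ↦ ?_)
  rw [norm_jw_mul, norm_mul, Complex.norm_real, Real.norm_eq_abs, abs_of_nonneg (hw_nonneg _ _)]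
  gcongr
  exact hw_le_jw b ξ

theorem hw_anti {a : ℝ} (h : BW (hw b) F A) (hab : a ≤ b) : BW (hw a) F A := by
  refine h.of_le h.1 (.of_forall fun ξ ↦ ?_)
  rw [norm_hw_mul, norm_hw_mul]
  gcongr
  exact jw_le hab ξ

theorem dMul_of_hw (h : BW (hw b) F A) (i : Fin d) : BW (jw b) (dMul i F) A := by
  refine h.of_le (aestronglyMeasurable_dMul h.1 i) (.of_forall fun ξ ↦ ?_)
  rw [norm_hw_mul, norm_jw_mul, dMul, norm_mul]
  have := jw_pos b ξ
  gcongr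
  exact norm_dSymbol_le i ξ

theorem dMul (h : BW (jw (b + 1)) F A) (i : Fin d) : BW (jw b) (dMul i F) A :=
  h.hw_of_jw.dMul_of_hw i

/-- Integrates `norm_mul_le_div_add_curl`. Only the homogeneous weight appears, since the symbols
give back exactly one factor `|2πξ|`. -/
theorem hw_of_div_curl {X : Fin d → E d → ℂ} (hX : ∀ j, AEStronglyMeasurable (X j) volume)
    (hdiv : BW (jw b) (∑ k, WeightedFriedrichs.dMul k (X k)) A)
    (hcurl : ∀ i j, BW (jw b) (WeightedFriedrichs.dMul i (X j) - WeightedFriedrichs.dMul j (X i)) B)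
    (j : Fin d) : BW (hw b) (X j) (A + d * B) := by
  have h1 := of_sum_le (m := jw b)
    (F := fun ξ ↦ ((∑ i, ‖(WeightedFriedrichs.dMul i (X j) -
      WeightedFriedrichs.dMul j (X i)) ξ‖ : ℝ) : ℂ)) Finset.univ ?_ (fun _ _ ↦ by fun_prop)
    (fun i _ ↦ hcurl i j) (.of_forall fun ξ ↦ ?_)
  · rw [Finset.sum_const, Finset.card_univ, Fintype.card_fin, nsmul_eq_mul] at h1
    refine of_le_add hdiv h1 (hX j) (by fun_prop) (by fun_prop) (.of_forall fun ξ ↦ ?_)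
    rw [norm_hw_mul, norm_jw_mul, norm_jw_mul, ← mul_add]
    refine mul_le_mul_of_nonneg_left ?_ (jw_pos b ξ).le
    rw [Complex.norm_real, Real.norm_eq_abs, abs_of_nonneg (by positivity)]
    simpa [WeightedFriedrichs.dMul, Finset.sum_apply]
      using norm_mul_le_div_add_curl (fun k ↦ X k ξ) ξ j
  · refine Complex.continuous_ofReal.comp_aestronglyMeasurable ?_
    exact Finset.aestronglyMeasurable_fun_sum _ fun i _ ↦ (hcurl i j).1.norm
  · simp only [norm_jw_mul]
    rw [← Finset.mul_sum, Complex.norm_real, Real.norm_eq_abs, abs_of_nonneg (by positivity)]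

end BW

/-! ### Interpolation -/

/-- Above the threshold `ε⁻¹ ^ (2 / (b - a))` the quotient of the weights is at least `ε⁻¹`; below
it the smaller weight is bounded. -/
theorem exists_jw_le_add {a b : ℝ} (ha : 0 ≤ a) (hab : a < b) {ε : ℝ} (hε : 0 < ε) :
    ∃ C : ℝ, 0 ≤ C ∧ ∀ ξ : E d, jw a ξ ≤ ε * jw b ξ + C := by
  refine ⟨(ε⁻¹ ^ (2 / (b - a))) ^ (a / 2), by positivity, fun ξ ↦ ?_⟩
  have hba : 0 < b - a := by linarith
  have hJ := jap_pos ξ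
  have hjb := jw_pos b ξ
  rcases le_total (ε⁻¹ ^ (2 / (b - a))) (jap ξ) with h | h
  · have h1 : ε⁻¹ ≤ jap ξ ^ ((b - a) / 2) := by
      have := Real.rpow_le_rpow (by positivity) h (by linarith : 0 ≤ (b - a) / 2)
      rwa [← Real.rpow_mul (by positivity), show 2 / (b - a) * ((b - a) / 2) = 1 by
        field_simp, Real.rpow_one] at this
    have h2 : jw b ξ = jw a ξ * jap ξ ^ ((b - a) / 2) := by
      rw [jw_eq, jw_eq, ← Real.rpow_add hJ]; ring_nf
    have h3 : jw a ξ ≤ ε * jw b ξ := by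
      rw [h2]
      have hja := jw_pos a ξ
      calc jw a ξ = ε * (jw a ξ * ε⁻¹) := by field_simp
        _ ≤ _ := by gcongr
    have : 0 ≤ (ε⁻¹ ^ (2 / (b - a))) ^ (a / 2) := by positivity
    linarith
  · have h1 : jw a ξ ≤ (ε⁻¹ ^ (2 / (b - a))) ^ (a / 2) := by
      rw [jw_eq]; gcongr
    have := mul_pos hε hjb
    linarith

theorem jw_le_hw_add {b : ℝ} (ξ : E d) : jw (b + 1) ξ ≤ hw b ξ + jw b ξ := by
  have h1 : jw (b + 1) ξ = Real.sqrt (jap ξ) * jw b ξ := by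
    rw [jw_eq, jw_eq, Real.sqrt_eq_rpow, ← Real.rpow_add (jap_pos ξ)]; ring_nf
  have hb := jw_pos b ξ
  have h2 : Real.sqrt (jap ξ) ≤ ‖(2 * Real.pi) • ξ‖ + 1 := by
    rw [Real.sqrt_le_left (by positivity)]
    unfold jap
    nlinarith [norm_nonneg ((2 * Real.pi) • ξ)]
  rw [h1, hw]
  nlinarith

/-- Interpolation between the homogeneous norm of order `s` and the `L²` norm. -/
theorem BW.exists_interpolation {σ s : ℝ} (hσ : 0 ≤ σ) (hσs : σ < s) (hs : 1 ≤ s) {ε : ℝ≥0}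
    (hε : 0 < ε) : ∃ C : ℝ≥0, ∀ (F : E d → ℂ) (A B : ℝ≥0), BW (hw (s - 1)) F A →
      BW (jw 0) F B → BW (jw σ) F (ε * A + C * B) := by
  -- From `jw s ≤ hw (s - 1) + jw (s - 1)` and `jw (s - 1) ≤ jw s / 2 + C2` follows `jw s ≤ 2 hw (s
  -- - 1) + 2 C2`; hence the choice `ε / 2` here.
  obtain ⟨C1, hC1, h1⟩ := exists_jw_le_add (d := d) hσ hσs (ε := ε / 2) (by positivity)
  obtain ⟨C2, hC2, h2⟩ := exists_jw_le_add (d := d) (a := s - 1) (b := s) (by linarith)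
    (by linarith) (ε := 1 / 2) (by norm_num)
  refine ⟨⟨ε * C2 + C1, by positivity⟩, fun F A B hA hB ↦ ?_⟩
  have e1 : ‖((ε : ℝ) : ℂ)‖₊ = ε := by ext; simp
  have e2 : ‖((ε * C2 + C1 : ℝ) : ℂ)‖₊ = ⟨ε * C2 + C1, by positivity⟩ := by
    ext; rw [coe_nnnorm, Complex.norm_real, Real.norm_eq_abs, abs_of_nonneg (by positivity)]; rfl
  have := BW.of_le_add (m := jw σ) (F := F) (hA.smul ((ε : ℝ) : ℂ))
    (hB.smul ((ε * C2 + C1 : ℝ) : ℂ)) hA.1 (by fun_prop) (by fun_prop) (.of_forall fun ξ ↦ ?_)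
  · rwa [e1, e2] at this
  have h3 := h1 ξ
  have h4 := h2 ξ
  have h5 := jw_le_hw_add (b := s - 1) ξ
  rw [sub_add_cancel] at h5
  have h6 : jw σ ξ ≤ ε * hw (s - 1) ξ + (ε * C2 + C1) * jw 0 ξ := by
    have h0 : jw 0 ξ = 1 := by simp [jw]
    have hε' : (0 : ℝ) < ε := hε
    rw [h0]
    nlinarith
  simp only [Pi.smul_apply, smul_eq_mul, norm_mul, Complex.norm_real, Real.norm_eq_abs,
    abs_of_pos (jw_pos _ ξ), abs_of_nonneg (hw_nonneg _ ξ)]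
  rw [abs_of_nonneg (show (0 : ℝ) ≤ ε from ε.2),
    abs_of_nonneg (show (0 : ℝ) ≤ ε * C2 + C1 by positivity)]
  calc jw σ ξ * ‖F ξ‖ ≤ (ε * hw (s - 1) ξ + (ε * C2 + C1) * jw 0 ξ) * ‖F ξ‖ := by gcongr
    _ = _ := by ring

/-! ### Helmholtz decomposition and the energy estimate -/

/-- The potential `Δ^{-1} div W` (up to sign), on the Fourier side. -/
def potential (W : Fin d → E d → ℂ) (ξ : E d) : ℂ :=
  (((‖(2 * Real.pi) • ξ‖ ^ 2 : ℝ) : ℂ))⁻¹ * ∑ k, dMul k (W k) ξ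

/-- Minus the gradient part of `W` in the Helmholtz decomposition, on the Fourier side. -/
def gradPart (W : Fin d → E d → ℂ) (j : Fin d) (ξ : E d) : ℂ := dSymbol j ξ * potential W ξ

theorem sum_dMul_gradPart (W : Fin d → E d → ℂ) (ξ : E d) :
    ∑ j, dMul j (gradPart W j) ξ = -∑ k, dMul k (W k) ξ := by
  simp only [dMul, gradPart, ← mul_assoc, ← Finset.sum_mul]
  rw [sum_dSymbol_sq, potential]
  -- At `ξ = 0` the inverse in `potential` is `0` by convention, harmlessly: all symbols vanish
  -- there.
  by_cases h : ‖(2 * Real.pi) • ξ‖ = 0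
  · have hD : ∀ k : Fin d, dSymbol k ξ = 0 := fun k ↦
      norm_eq_zero.1 (le_antisymm ((norm_dSymbol_le k ξ).trans h.le) (norm_nonneg _))
    simp [dMul, hD]
  · have : ((‖(2 * Real.pi) • ξ‖ ^ 2 : ℝ) : ℂ) ≠ 0 := by
      exact_mod_cast pow_ne_zero 2 h
    rw [neg_mul, mul_inv_cancel_left₀ this]
    rfl

theorem curl_gradPart (W : Fin d → E d → ℂ) (i j : Fin d) :
    dMul i (gradPart W j) - dMul j (gradPart W i) = 0 := by
  ext ξ
  simp only [Pi.sub_apply, dMul, gradPart, Pi.zero_apply]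
  ring

theorem norm_gradPart_le (W : Fin d → E d → ℂ) (j : Fin d) (ξ : E d) :
    ‖gradPart W j ξ‖ ≤ ∑ k, ‖W k ξ‖ := by
  set n := ‖(2 * Real.pi) • ξ‖ with hn
  have hn0 : 0 ≤ n := norm_nonneg _
  rw [gradPart, potential, norm_mul, norm_mul, norm_inv, Complex.norm_real, Real.norm_eq_abs,
    ← hn, abs_of_nonneg (by positivity)]
  rcases hn0.eq_or_lt with h | h
  · rw [← h]; simp; positivity
  calc ‖dSymbol j ξ‖ * ((n ^ 2)⁻¹ * ‖∑ k, dMul k (W k) ξ‖)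
      ≤ n * ((n ^ 2)⁻¹ * ∑ k, n * ‖W k ξ‖) := by
        gcongr
        · exact norm_dSymbol_le j ξ
        · refine norm_sum_le_of_le _ fun k _ ↦ ?_
          rw [dMul, norm_mul]
          gcongr
          exact norm_dSymbol_le k ξ
    _ = ∑ k, ‖W k ξ‖ := by
        rw [← Finset.mul_sum]; field_simp

theorem aestronglyMeasurable_gradPart {W : Fin d → E d → ℂ}
    (hW : ∀ k, AEStronglyMeasurable (W k) volume) (j : Fin d) :
    AEStronglyMeasurable (gradPart W j) volume := by
  refine (continuous_dSymbol j).aestronglyMeasurable.mul (AEStronglyMeasurable.mul ?_ ?_)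
  · exact Measurable.aestronglyMeasurable (by fun_prop)
  · exact Finset.aestronglyMeasurable_fun_sum _ fun k _ ↦ aestronglyMeasurable_dMul (hW k) k

theorem BW.gradPart_of_forall {W : Fin d → E d → ℂ} {m : E d → ℝ} {A : ℝ≥0} (hm : Measurable m)
    (hW : ∀ k, BW m (W k) A) (j : Fin d) : BW m (gradPart W j) (d * A) := by
  have := BW.of_sum_le (m := m) (F := gradPart W j) Finset.univ
    (aestronglyMeasurable_gradPart (fun k ↦ (hW k).1) j) (fun _ _ ↦ hm) (fun k _ ↦ hW k)
    (.of_forall fun ξ ↦ ?_)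
  · rwa [Finset.sum_const, Finset.card_univ, Fintype.card_fin, nsmul_eq_mul] at this
  simp only [norm_mul, ← Finset.mul_sum]
  gcongr
  exact norm_gradPart_le W j ξ

theorem integral_norm_sq_eq {f : E d → ℂ} (hf : MemLp f 2 volume) :
    ∫ x, ‖f x‖ ^ 2 = (eLpNorm f 2 volume).toReal ^ 2 := by
  rw [hf.eLpNorm_eq_integral_rpow_norm (by norm_num) (by norm_num),
    ENNReal.toReal_ofReal (by positivity)]
  have h0 : 0 ≤ ∫ x, ‖f x‖ ^ 2 := by positivity
  simp only [ENNReal.toReal_ofNat, Real.rpow_two]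
  rw [← Real.rpow_mul_natCast h0]
  norm_num

/-- The energy identity `⟨(1 + α) u, u⟩ = -⟨α (v - u), u⟩` for the gradient part `u`. -/
theorem sum_integral_energy {α : E d → ℂ} {v u W : Fin d → E d → ℂ}
    (hW : ∀ j, IsFT (α * v j) (W j))
    (hu : ∀ j, IsFT (u j) (gradPart W j)) :
    ∑ j, ∫ x, (u j x + α x * v j x) * (starRingEnd ℂ) (u j x) = 0 := by
  have h1 : ∀ j, ∫ x, (u j x + α x * v j x) * (starRingEnd ℂ) (u j x)
      = ∫ ξ, (gradPart W j ξ + W j ξ) * (starRingEnd ℂ) (gradPart W j ξ) := fun j ↦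
    ((hu j).add (hW j)).integral_mul_conj (hu j)
  simp only [h1]
  rw [← integral_finsetSum]
  · rw [← integral_zero (E d) ℂ]
    refine integral_congr_ae (.of_forall fun ξ ↦ ?_)
    have h2 := sum_dMul_gradPart W ξ
    -- Pairing a field with a gradient is pairing its divergence with the potential, and the
    -- divergence of `u + α v` vanishes.
    have h3 : ∀ j, (gradPart W j ξ + W j ξ) * (starRingEnd ℂ) (gradPart W j ξ)
        = -(starRingEnd ℂ) (potential W ξ) * (dMul j (gradPart W j) ξ + dMul j (W j) ξ) := by
      intro j
      have : (starRingEnd ℂ) (gradPart W j ξ) = -dSymbol j ξ * (starRingEnd ℂ) (potential W ξ) := by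
        rw [gradPart, map_mul, conj_dSymbol]
      rw [this, dMul, dMul]
      ring
    simp only [h3]
    rw [← Finset.mul_sum, Finset.sum_add_distrib, h2, neg_add_cancel, mul_zero]
  · intro j _
    exact (((hu j).memLp'.add (hW j).memLp').integrable_mul (hu j).memLp'.star)

/-- The weighted energy estimate. -/
theorem BW.energy {α : E d → ℝ} {ρ : ℝ} {v u W : Fin d → E d → ℂ} {P a : ℝ≥0} (hα : MemLp (fun x ↦ (α x : ℂ)) 2 volume)
    (hαa : eLpNorm (fun x ↦ (α x : ℂ)) 2 volume ≤ a)
    (hρ : 0 < ρ) (hlow : ∀ᵐ x, ρ ≤ 1 + α x)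
    (hW : ∀ j, IsFT ((fun x ↦ (α x : ℂ)) * v j) (W j))
    (hu : ∀ j, IsFT (u j) (gradPart W j))
    (hP : ∀ j, ∀ᵐ x, ‖v j x - u j x‖ ≤ P) (j : Fin d) :
    BW (jw 0) (gradPart W j) (d * Real.toNNReal ρ⁻¹ * P * a) := by
  set ℓ : Fin d → ℝ := fun j ↦ (eLpNorm (u j) 2 volume).toReal with hℓ
  have hℓ0 : ∀ j, 0 ≤ ℓ j := fun j ↦ ENNReal.toReal_nonneg
  have hE := sum_integral_energy hW hu
  set a' := (eLpNorm (fun x ↦ (α x : ℂ)) 2 volume).toReal with ha'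
  have haa : a' ≤ a := by
    rw [ha']; exact ENNReal.toReal_le_coe_of_le_coe hαa
  have hau : ∀ j, Integrable fun x ↦ |α x| * ‖u j x‖ := fun j ↦ by
    have h := hα.norm.integrable_mul (hu j).memLp.norm
    simp only [Complex.norm_real, Real.norm_eq_abs] at h
    exact h
  have hcs : ∀ j, ∫ x, |α x| * ‖u j x‖ ≤ a' * ℓ j := by
    intro j
    have h := integral_mul_norm_le_Lp_mul_Lq (μ := (volume : Measure (E d)))
      (p := 2) (q := 2) (f := fun x ↦ (α x : ℂ)) (g := u j)
      (by constructor <;> norm_num) (by simpa using hα) (by simpa using (hu j).memLp)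
    have e1 := integral_norm_sq_eq hα
    have e2 := integral_norm_sq_eq (hu j).memLp
    simp only [Real.rpow_two, e2, Complex.norm_real, Real.norm_eq_abs] at h
    simp only [← Real.sqrt_eq_rpow, sq_abs] at h
    have e3 := e1
    simp only [Complex.norm_real, Real.norm_eq_abs, sq_abs] at e3
    rwa [e3, Real.sqrt_sq ENNReal.toReal_nonneg, Real.sqrt_sq ENNReal.toReal_nonneg] at h
  -- Writing `u + α v = (1 + α) u + α (v - u)`, the first part is coercive by `ρ ≤ 1 + α`, and the
  -- second is at most `P |α| |u|` after pairing.
  have hterm : ∀ j, ρ * ℓ j ^ 2 - P * (a' * ℓ j) ≤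
      (∫ x, (u j x + (α x : ℂ) * v j x) * (starRingEnd ℂ) (u j x)).re := by
    intro j
    have hint : Integrable fun x ↦ (u j x + (α x : ℂ) * v j x) * (starRingEnd ℂ) (u j x) :=
      ((hu j).memLp.add (hW j).memLp).integrable_mul (hu j).memLp.star
    have hu2 : Integrable fun x ↦ ‖u j x‖ ^ 2 := (hu j).memLp.integrable_norm_pow (by norm_num)
    have h1 : (∫ x, (u j x + (α x : ℂ) * v j x) * (starRingEnd ℂ) (u j x)).re
        = ∫ x, ((u j x + (α x : ℂ) * v j x) * (starRingEnd ℂ) (u j x)).re :=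
      (integral_re hint).symm
    rw [h1]
    calc ρ * ℓ j ^ 2 - P * (a' * ℓ j)
        ≤ ρ * (∫ x, ‖u j x‖ ^ 2) - P * ∫ x, |α x| * ‖u j x‖ := by
          rw [integral_norm_sq_eq (hu j).memLp]
          have := mul_le_mul_of_nonneg_left (hcs j) P.2
          linarith!
      _ = ∫ x, (ρ * ‖u j x‖ ^ 2 - P * (|α x| * ‖u j x‖)) := by
          rw [integral_sub (hu2.const_mul _) ((hau j).const_mul _), integral_const_mul,
            integral_const_mul]
      _ ≤ _ := by
          refine integral_mono_ae ((hu2.const_mul _).sub ((hau j).const_mul _)) hint.re ?_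
          filter_upwards [hlow, hP j] with x hx1 hx2
          have e1 : (u j x + (α x : ℂ) * v j x) * (starRingEnd ℂ) (u j x)
              = (((1 + α x) * ‖u j x‖ ^ 2 : ℝ) : ℂ) +
                (α x : ℂ) * ((v j x - u j x) * (starRingEnd ℂ) (u j x)) := by
            push_cast
            rw [← Complex.mul_conj']
            ring
          have e2 : ((u j x + (α x : ℂ) * v j x) * (starRingEnd ℂ) (u j x)).re
              = (1 + α x) * ‖u j x‖ ^ 2 +
                α x * ((v j x - u j x) * (starRingEnd ℂ) (u j x)).re := by
            rw [e1, Complex.add_re, Complex.ofReal_re, Complex.re_ofReal_mul]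
          have e3 : |((v j x - u j x) * (starRingEnd ℂ) (u j x)).re| ≤ P * ‖u j x‖ := by
            refine (Complex.abs_re_le_norm _).trans ?_
            rw [norm_mul, RCLike.norm_conj]
            gcongr
          have e4 : -(|α x| * (P * ‖u j x‖)) ≤
              α x * ((v j x - u j x) * (starRingEnd ℂ) (u j x)).re := by
            refine (abs_le.1 ?_).1
            rw [abs_mul]
            gcongr
          change _ ≤ ((u j x + (α x : ℂ) * v j x) * (starRingEnd ℂ) (u j x)).re
          rw [e2]
          have e5 : ρ * ‖u j x‖ ^ 2 ≤ (1 + α x) * ‖u j x‖ ^ 2 := by gcongr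
          linarith
  have hsum : ρ * ∑ j, ℓ j ^ 2 ≤ P * a' * ∑ j, ℓ j := by
    have h1 := congrArg Complex.re hE
    rw [Complex.re_sum, Complex.zero_re] at h1
    have h2 := Finset.sum_le_sum fun j (_ : j ∈ Finset.univ) ↦ hterm j
    rw [h1, Finset.sum_sub_distrib, ← Finset.mul_sum, ← Finset.mul_sum, ← Finset.mul_sum] at h2
    linarith
  -- Cauchy–Schwarz over the components costs the factor `d`; one power of the sum is then
  -- cancelled.
  have hT : ∑ j, ℓ j ≤ d * ρ⁻¹ * P * a' := by
    set T := ∑ j, ℓ j with hTdef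
    have hT0 : 0 ≤ T := Finset.sum_nonneg fun j _ ↦ hℓ0 j
    have h1 : T ^ 2 ≤ d * ∑ j, ℓ j ^ 2 := by
      simpa using sq_sum_le_card_mul_sum_sq (s := Finset.univ) (f := ℓ)
    rcases hT0.eq_or_lt with h0 | h0
    · rw [← h0]; positivity
    refine le_of_mul_le_mul_right ?_ h0
    have h2 : ∑ j, ℓ j ^ 2 ≤ ρ⁻¹ * (P * a' * T) := by
      rw [le_inv_mul_iff₀ hρ]; exact hsum
    calc T * T = T ^ 2 := by ring
      _ ≤ d * (ρ⁻¹ * (P * a' * T)) := h1.trans (by gcongr)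
      _ = _ := by ring
  refine ⟨(hu j).memLp'.1, ?_⟩
  have h0 : wN (jw 0) (gradPart W j) = eLpNorm (u j) 2 volume := by
    rw [(hu j).eLpNorm_eq, wN]
    simp [jw]
  rw [h0, ← ENNReal.ofReal_coe_nnreal]
  refine ENNReal.le_ofReal_iff_toReal_le (hu j).memLp.2.ne (by positivity) |>.2 ?_
  push_cast
  rw [Real.coe_toNNReal _ (by positivity)]
  calc ℓ j ≤ ∑ j, ℓ j := Finset.single_le_sum (fun j _ ↦ hℓ0 j) (Finset.mem_univ j)
    _ ≤ d * ρ⁻¹ * P * a' := hT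
    _ ≤ _ := by gcongr

/-! ### Low-order control and the divergence identity -/

theorem BW.integrable_jw {t : ℝ} {F : E d → ℂ} {a : ℝ≥0} (h : BW (jw t) F a)
    (ht : (d : ℝ) / 2 < t) : Integrable F :=
  h.integrable (admissible_jw t) ht

theorem IsFT.mul_of_BW {t : ℝ} {f g F G : E d → ℂ} {a b : ℝ≥0} (ht : (d : ℝ) / 2 < t)
    (hf : IsFT f F) (hg : IsFT g G) (hF : BW (jw t) F a) (hG : BW (jw t) G b) :
    IsFT (f * g) (conv F G) := by
  have ht0 : 0 ≤ t := le_trans (by positivity) ht.le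
  obtain ⟨K, hK⟩ := (admissible_jw (d := d) t).exists_conv ht0 le_rfl ht
  exact hf.mul hg (hF.integrable_jw ht) ((hK _ _ _ _ hF hG).memLp ht0)

theorem dMul_conv {s : ℝ} (hs : (d : ℝ) / 2 < s) {F G : E d → ℂ} {a b : ℝ≥0}
    (hF : BW (jw (s + 1)) F a) (hG : BW (jw (s + 1)) G b) (i : Fin d) :
    dMul i (conv F G) =ᵐ[volume] conv (dMul i F) G + conv F (dMul i G) :=
  dSymbol_mul_conv i (hF.integrable_jw (by linarith)) (hG.integrable_jw (by linarith))
    ((hF.dMul i).integrable_jw hs) ((hG.dMul i).integrable_jw hs)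

theorem conv_add_right {F G H : E d → ℂ} (hF : Integrable F) (hG : Integrable G)
    (hH : Integrable H) : conv F (G + H) =ᵐ[volume] conv F G + conv F H := by
  filter_upwards [ae_integrable_conv hF hG, ae_integrable_conv hF hH] with ξ h1 h2
  rw [Pi.add_apply, conv, conv, conv, ← integral_add h1 h2]
  simp only [Pi.add_apply, mul_add]

theorem conv_sum_right {ι : Type*} (s : Finset ι) {F : E d → ℂ} {G : ι → E d → ℂ}
    (hF : Integrable F) (hG : ∀ i ∈ s, Integrable (G i)) :
    conv F (∑ i ∈ s, G i) =ᵐ[volume] ∑ i ∈ s, conv F (G i) := by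
  have h : ∀ᵐ ξ, ∀ i ∈ s, Integrable fun t ↦ F t * G i (ξ - t) :=
    (ae_ball_iff s.countable_toSet).2 fun i hi ↦ ae_integrable_conv hF (hG i hi)
  filter_upwards [h] with ξ hξ
  rw [Finset.sum_apply, conv]
  simp only [conv, Finset.sum_apply, Finset.mul_sum]
  exact integral_finsetSum _ hξ

/-- Low-order control: the difference of a field `v` and the solution of the constant-coefficient
div-curl system with data `div (e^φ v)` and `curl v`. -/
theorem exists_lowOrder (hd : 3 ≤ d) {s : ℝ} (hs : (d : ℝ) / 2 < s) (C₁ M : ℝ≥0) :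
    ∃ c : ℝ≥0, ∀ (φ : E d → ℝ) (A : E d → ℂ) (v V G : Fin d → E d → ℂ) (δ r : ℝ≥0),
      (∀ᵐ x, |φ x| ≤ M) → IsFT (fun x ↦ ((Real.exp (φ x) - 1 : ℝ) : ℂ)) A → BW (jw s) A C₁ →
      (∀ j, IsFT (v j) (V j)) → (∀ j, BW (jw s) (V j) r) →
      (∀ j, IsFT (fun x ↦ (Real.exp (φ x) : ℂ) * v j x) (G j)) →
      BW (jw s) (∑ j, dMul j (G j)) δ →
      (∀ i j, BW (jw s) (dMul i (V j) - dMul j (V i)) δ) →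
      ∀ j, BW (jw 0) (gradPart (fun k ↦ conv A (V k)) j) (c * δ) ∧
        BW (hw s) (V j - gradPart (fun k ↦ conv A (V k)) j) (c * δ) ∧
        (∑ k, dMul k (gradPart (fun k ↦ conv A (V k)) k)) =ᵐ[volume]
          ∑ k, dMul k (V k) - ∑ k, dMul k (G k) := by
  -- In the constant below, the first summand is the energy bound with `ρ = e^{-M}`, `P = L (1 + d)
  -- δ` and `‖α‖ ≤ C₁`; the second bounds `v - u`.
  obtain ⟨L, hL⟩ := (admissible_hw hd s).exists_integral_le hs
  refine ⟨d * Real.toNNReal (Real.exp (-M))⁻¹ * (L * (1 + d)) * C₁ + (1 + d),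
    fun φ A v V G δ r hM hA hAC hv hV hG hF hcurl j ↦ ?_⟩
  have hs0 : 0 ≤ s := le_trans (by positivity) hs.le
  set W : Fin d → E d → ℂ := fun k ↦ conv A (V k) with hWdef
  have hW : ∀ k, IsFT ((fun x ↦ ((Real.exp (φ x) - 1 : ℝ) : ℂ)) * v k) (W k) := fun k ↦
    hA.mul_of_BW hs (hv k) hAC (hV k)
  have hGW : ∀ k, G k =ᵐ[volume] V k + W k := fun k ↦ by
    refine (hG k).unique (((hv k).add (hW k)).congr (.of_forall fun x ↦ ?_) ae_eq_rfl)
    simp only [Pi.add_apply, Pi.mul_apply]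
    push_cast
    ring
  have hGWall : ∀ᵐ ξ, ∀ k, G k ξ = V k ξ + W k ξ := ae_all_iff.2 fun k ↦ hGW k
  have hdivU : (∑ k, dMul k (gradPart W k)) =ᵐ[volume]
      ∑ k, dMul k (V k) - ∑ k, dMul k (G k) := by
    filter_upwards [hGWall] with ξ hξ
    simp only [Finset.sum_apply, Pi.sub_apply]
    rw [sum_dMul_gradPart]
    simp only [dMul, hξ, mul_add, Finset.sum_add_distrib]
    ring
  have hU : ∀ k, MemLp (gradPart W k) 2 volume := fun k ↦ by
    obtain ⟨K, hK⟩ := (admissible_jw (d := d) s).exists_conv hs0 le_rfl hs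
    exact (BW.gradPart_of_forall (by fun_prop) (fun k ↦ hK _ _ _ _ hAC (hV k)) k).memLp hs0
  choose u hu using fun k ↦ IsFT.exists_fourierInv (hU k)
  -- `u` has divergence `-div (α v)` and no curl, so `v - u` has divergence `div (e^φ v)` and the
  -- curl of `v`.
  have hdiv0 : BW (jw s) (∑ k, dMul k (V k - gradPart W k)) δ := by
    refine hF.congr ?_
    filter_upwards [hdivU] with ξ hξ
    have h1 : (∑ k, dMul k (V k - gradPart W k)) ξ
        = (∑ k, dMul k (V k)) ξ - (∑ k, dMul k (gradPart W k)) ξ := by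
      simp only [Finset.sum_apply, dMul, Pi.sub_apply, mul_sub, Finset.sum_sub_distrib]
    rw [h1, hξ, Pi.sub_apply, sub_sub_cancel]
  have hcurl0 : ∀ i j, BW (jw s)
      (dMul i (V j - gradPart W j) - dMul j (V i - gradPart W i)) δ := by
    intro i j
    refine (hcurl i j).congr (.of_forall fun ξ ↦ ?_)
    have h1 := congrFun (curl_gradPart W i j) ξ
    simp only [Pi.sub_apply, dMul, Pi.zero_apply, mul_sub] at h1 ⊢
    linear_combination h1
  have hV0 : ∀ j, BW (hw s) (V j - gradPart W j) (δ + d * δ) :=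
    BW.hw_of_div_curl (fun j ↦ (hv j).memLp'.1.sub (hU j).1) hdiv0 hcurl0
  -- The homogeneous norm does not control `v - u` in `L²`, but admissibility of `hw (s - 1)` still
  -- gives a sup bound linear in `δ`.
  have hsup : ∀ j, ∀ᵐ x, ‖v j x - u j x‖ ≤ (L * (δ + d * δ) : ℝ≥0) := by
    intro j
    obtain ⟨h1, h2⟩ := hL _ _ ((hV0 j).hw_anti (by linarith : s - 1 ≤ s))
    filter_upwards [((hv j).sub (hu j)).norm_le_integral h1] with x hx
    exact hx.trans (by exact_mod_cast h2)
  have hα : eLpNorm (fun x ↦ ((Real.exp (φ x) - 1 : ℝ) : ℂ)) 2 volume ≤ C₁ := by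
    rw [hA.eLpNorm_eq]
    simpa [wN, jw] using (hAC.anti hs0).2
  have hlow : ∀ᵐ x, Real.exp (-M) ≤ 1 + (Real.exp (φ x) - 1) := by
    filter_upwards [hM] with x hx
    rw [add_sub_cancel, Real.exp_le_exp]
    exact (abs_le.1 hx).1
  refine ⟨(BW.energy hA.memLp hα (Real.exp_pos _) hlow hW hu hsup j).mono ?_,
    (hV0 j).mono ?_, hdivU⟩
  · rw [add_mul]
    refine le_trans (le_of_eq ?_) le_self_add
    ring
  · rw [add_mul]
    refine le_trans (le_of_eq ?_) le_add_self
    ring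

/-- The divergence of `v = (1 + β) g` in terms of the divergence of `g`. -/
theorem div_eq_of_weighted {s : ℝ} (hs : (d : ℝ) / 2 < s) {α β : E d → ℂ} {A B : E d → ℂ}
    {v V g G : Fin d → E d → ℂ} {a b r : ℝ≥0} (hαβ : ∀ x, (1 + α x) * (1 + β x) = 1)
    (hA : IsFT α A) (hB : IsFT β B) (hAa : BW (jw s) A a) (hBb : BW (jw (s + 1)) B b)
    (hv : ∀ j, IsFT (v j) (V j)) (hg : ∀ j, IsFT (g j) (G j)) (hV : ∀ j, BW (jw s) (V j) r)
    (hG : ∀ j, BW (jw (s + 1)) (G j) r) (hgv : ∀ j x, g j x = (1 + α x) * v j x) :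
    (∑ j, dMul j (V j)) =ᵐ[volume] (∑ j, dMul j (G j)) + conv B (∑ j, dMul j (G j)) +
      ∑ j, conv (dMul j B + conv A (dMul j B)) (V j) := by
  have hs0 : 0 ≤ s := le_trans (by positivity) hs.le
  obtain ⟨K, hK⟩ := (admissible_jw (d := d) s).exists_conv hs0 le_rfl hs
  have hBs : BW (jw s) B b := hBb.anti (by linarith)
  have hGs : ∀ j, BW (jw s) (G j) r := fun j ↦ (hG j).anti (by linarith)
  have hdB : ∀ j, BW (jw s) (dMul j B) b := fun j ↦ hBb.dMul j
  have hdG : ∀ j, BW (jw s) (dMul j (G j)) r := fun j ↦ (hG j).dMul j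
  have h1 : ∀ j, dMul j (V j) =ᵐ[volume] dMul j (G j) + conv B (dMul j (G j)) +
      conv (dMul j B + conv A (dMul j B)) (V j) := by
    intro j
    have e1 : V j =ᵐ[volume] G j + conv B (G j) := by
      refine (hv j).unique (((hg j).add (hB.mul_of_BW hs (hg j) hBs (hGs j))).congr
        (.of_forall fun x ↦ ?_) ae_eq_rfl)
      simp only [Pi.add_apply, Pi.mul_apply, hgv]
      linear_combination v j x * hαβ x
    have e2 := dMul_conv hs hBb (hG j) j
    obtain ⟨h, hh⟩ := IsFT.exists_fourierInv ((hdB j).memLp hs0)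
    -- Here `g = (1 + α) v` is substituted and `1 + α` is moved onto `∂_j β`, so that the
    -- coefficient of `v` becomes `e^φ ∂_j e^{-φ} = -∂_j φ`.
    have e3 : conv (dMul j B) (G j) =ᵐ[volume]
        conv (dMul j B + conv A (dMul j B)) (V j) := by
      have q1 := hh.mul_of_BW hs (hg j) (hdB j) (hGs j)
      have q2 := (hh.add (hA.mul_of_BW hs hh hAa (hdB j))).mul_of_BW hs (hv j)
        ((hdB j).add (hK _ _ _ _ hAa (hdB j)) (by fun_prop)) (hV j)
      refine (q1.congr (.of_forall fun x ↦ ?_) ae_eq_rfl).unique q2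
      simp only [Pi.add_apply, Pi.mul_apply, hgv]
      ring
    filter_upwards [e1, e2, e3] with ξ h1 h2 h3
    have : dMul j (V j) ξ = dMul j (G j) ξ + dMul j (conv B (G j)) ξ := by
      simp only [dMul, h1, Pi.add_apply, mul_add]
    rw [this, h2]
    simp only [Pi.add_apply] at h3 ⊢
    rw [h3]
    ring
  have h2 := conv_sum_right Finset.univ (hBs.integrable_jw hs)
    (fun j _ ↦ (hdG j).integrable_jw hs)
  filter_upwards [ae_all_iff.2 h1, h2] with ξ h1 h2
  simp only [Pi.add_apply] at h1 ⊢
  rw [h2]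
  simp only [Finset.sum_apply, h1, Finset.sum_add_distrib]

/-! ### The weighted div-curl estimate -/

theorem BW.zero (m : E d → ℝ) : BW m (0 : E d → ℂ) 0 :=
  ⟨aestronglyMeasurable_zero, by simp [wN]⟩

/-- Any finite bound may be replaced by the norm itself; the absorption argument needs the exact
norm on both sides. -/
theorem BW.exact {m : E d → ℝ} {F : E d → ℂ} {a : ℝ≥0} (h : BW m F a) :
    BW m F (wN m F).toNNReal :=
  ⟨h.1, (ENNReal.coe_toNNReal (ne_top_of_le_ne_top ENNReal.coe_ne_top h.2)).ge⟩

theorem BW.toNNReal_le {m : E d → ℝ} {F : E d → ℂ} {a : ℝ≥0} (h : BW m F a) :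
    (wN m F).toNNReal ≤ a := by
  simpa using ENNReal.toNNReal_mono ENNReal.coe_ne_top h.2

theorem exp_neg_weight (φ : E d → ℝ) (x : E d) :
    (1 + ((Real.exp (φ x) - 1 : ℝ) : ℂ)) * (1 + ((Real.exp (-φ x) - 1 : ℝ) : ℂ)) = 1 := by
  rw [← Complex.ofReal_one, ← Complex.ofReal_add, ← Complex.ofReal_add, ← Complex.ofReal_mul,
    add_sub_cancel, add_sub_cancel, ← Real.exp_add, add_neg_cancel, Real.exp_zero]

theorem IsFT.neg_ofReal {φ : E d → ℝ} {Φ : E d → ℂ} (h : IsFT (fun x ↦ (φ x : ℂ)) Φ) :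
    IsFT (fun x ↦ ((-φ x : ℝ) : ℂ)) (-Φ) :=
  h.neg.congr (.of_forall fun x ↦ by simp) ae_eq_rfl

/-- The weighted div-curl estimate on the Fourier side. -/
theorem exists_weighted_div_curl (hd : 3 ≤ d) {s : ℝ} (hs : (d : ℝ) / 2 < s - 1 / 4) (R : ℝ≥0) :
    ∃ C : ℝ≥0, ∀ (φ : E d → ℝ) (Φ : E d → ℂ) (v V G : Fin d → E d → ℂ) (R' δ r : ℝ≥0),
      IsFT (fun x ↦ (φ x : ℂ)) Φ → BW (jw s) Φ R → BW (jw (s + 1)) Φ R' →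
      (∀ j, IsFT (v j) (V j)) → (∀ j, BW (jw (s + 1)) (V j) r) →
      (∀ j, IsFT (fun x ↦ (Real.exp (φ x) : ℂ) * v j x) (G j)) →
      (∀ j, BW (jw (s + 1)) (G j) r) →
      BW (jw s) (∑ j, dMul j (G j)) δ →
      (∀ i j, BW (jw s) (dMul i (V j) - dMul j (V i)) δ) →
      ∀ j, BW (hw s) (V j) (C * (1 + R') * δ) := by
  have hd' : (3 : ℝ) ≤ d := by exact_mod_cast hd
  have hs' : (d : ℝ) / 2 < s := by linarith
  have hs1 : 1 ≤ s := by linarith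
  obtain ⟨C₁, M, hE⟩ := exists_exp_sub_one (d := d) hs' R
  obtain ⟨c, hc⟩ := exists_lowOrder hd hs' C₁ M
  obtain ⟨K₁, hK₁⟩ := (admissible_jw (d := d) s).exists_conv (a := s - 1) (by linarith)
    (by linarith) hs'
  obtain ⟨K₂, hK₂⟩ := (admissible_jw (d := d) s).exists_conv (a := s) (by linarith) le_rfl hs'
  obtain ⟨K₃, hK₃⟩ := (admissible_hw hd s).exists_conv (a := s - 1) (by linarith)
    (by linarith) hs'
  obtain ⟨K₄, hK₄⟩ := (admissible_hw hd s).exists_conv (a := s) (by linarith) le_rfl hs'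
  obtain ⟨K₅, hK₅⟩ := (admissible_jw (d := d) (s - 1 / 4)).exists_conv (a := s - 1) (by linarith)
    (by linarith) hs
  set q : ℝ≥0 := C₁ + K₁ * C₁ * C₁ with hq
  set q' : ℝ≥0 := C₁ + K₂ * C₁ * C₁ with hq'
  -- Chosen so that `d * (K₅ * q) * ε ≤ 1 / 2`; the `+ 1` keeps the inverse meaningful when `K₅ * q
  -- = 0`.
  set ε : ℝ≥0 := (2 * (d * (K₅ * q) + 1))⁻¹ with hε
  have hε0 : 0 < ε := by positivity
  obtain ⟨D, hD⟩ := BW.exists_interpolation (d := d) (σ := s - 1 / 4) (s := s) (by linarith)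
    (by linarith) hs1 hε0
  set c' : ℝ≥0 := 1 + K₂ * C₁ + d * (K₃ * q * c) + d * (K₅ * q) * (ε + D * c) with hc'
  refine ⟨1 + K₂ * C₁ + d * (K₄ * q' * (2 * c' + d)) + d,
    fun φ Φ v V G R' δ r hφ hR hR' hv hV hg hG hF hcurl j ↦ ?_⟩
  obtain ⟨hM, A, hA, hAs, -⟩ := hE φ Φ R' hφ hR hR'
  obtain ⟨-, B, hB, hBs, hBs'⟩ := hE (fun x ↦ -φ x) (-Φ) R' hφ.neg_ofReal hR.neg hR'.neg
  have hVs : ∀ j, BW (jw s) (V j) r := fun j ↦ (hV j).anti (by linarith)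
  set U : Fin d → E d → ℂ := gradPart fun k ↦ conv A (V k) with hU
  have hlow := hc φ A v V G δ r hM hA hAs hv hVs hg hF hcurl
  set L := ∑ j, dMul j (V j) with hL
  -- Finite because `v` lies in `H^{s+1}`, but not yet bounded in terms of `δ`.
  set N := (wN (jw (s - 1)) L).toNNReal with hN
  have hLN : BW (jw (s - 1)) L N := by
    have h1 : BW (jw s) L _ := BW.sum Finset.univ (fun j _ ↦ (hV j).dMul j) (by fun_prop)
    exact (h1.anti (by linarith)).exact
  have hUdiv : BW (jw (s - 1)) (∑ k, dMul k (U k)) (N + δ) :=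
    (hLN.sub (hF.anti (by linarith)) (by fun_prop)).congr (hlow j).2.2.symm
  -- `u` is curl free with divergence of size `N + δ`, and its `L²` norm is at most `c δ`;
  -- interpolation makes the coefficient of `N` small.
  have hUs : ∀ j, BW (jw (s - 1 / 4)) (U j) (ε * (N + δ) + D * (c * δ)) := by
    intro j
    have h1 := BW.hw_of_div_curl (fun j ↦ (hlow j).1.1) hUdiv (B := 0) (fun i j ↦ by
      rw [curl_gradPart]; exact BW.zero _) j
    rw [mul_zero, add_zero] at h1
    exact hD _ _ _ h1 (hlow j).1
  -- The transform of `e^φ ∂_j e^{-φ}`. Its `H^{s-1}` norm is bounded through `R` alone, its `H^s`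
  -- norm linearly in `R'`.
  set Q : Fin d → E d → ℂ := fun j ↦ dMul j B + conv A (dMul j B) with hQ
  have hB1 : ∀ j, BW (jw (s - 1)) (dMul j B) C₁ := fun j ↦ by
    have : BW (jw (s - 1 + 1)) B C₁ := by rwa [sub_add_cancel]
    exact this.dMul j
  have hB2 : ∀ j, BW (jw s) (dMul j B) (C₁ * R') := fun j ↦ hBs'.dMul j
  have hQ1 : ∀ j, BW (jw (s - 1)) (Q j) q := fun j ↦ by
    have h1 := hK₁ _ _ _ _ (hB1 j) hAs
    rw [conv_comm] at h1
    exact (hB1 j).add h1 (by fun_prop)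
  have hQ2 : ∀ j, BW (jw s) (Q j) (q' * R') := fun j ↦
    ((hB2 j).add (hK₂ _ _ _ _ hAs (hB2 j)) (by fun_prop)).mono
      (le_of_eq (by rw [hq']; ring))
  have hLeq := div_eq_of_weighted hs' (exp_neg_weight φ) hA hB hAs hBs' hv hg hVs hG
    (fun j x ↦ by push_cast; ring)
  have hsplit : ∀ j, conv (Q j) (V j) =ᵐ[volume]
      conv (Q j) (V j - U j) + conv (Q j) (U j) := fun j ↦ by
    have h1 := conv_add_right ((hQ2 j).integrable_jw hs')
      (((hlow j).2.1.hw_anti (by linarith : s - 1 ≤ s)).integrable (admissible_hw hd s) hs')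
      ((hUs j).integrable_jw hs)
    rwa [sub_add_cancel] at h1
  have hconvB := hK₂ _ _ _ _ hBs hF
  have hlo1 : BW (jw (s - 1)) L (δ + K₂ * C₁ * δ +
      ∑ _j : Fin d, (K₃ * q * (c * δ) + K₅ * q * (ε * (N + δ) + D * (c * δ)))) := by
    refine BW.congr ?_ hLeq.symm
    refine ((hF.anti (by linarith)).add (hconvB.anti (by linarith)) (by fun_prop)).add
      (BW.sum _ (fun j _ ↦ ?_) (by fun_prop)) (by fun_prop)
    refine BW.congr ?_ (hsplit j).symm
    exact (hK₃ _ _ _ _ (hQ1 j) ((hlow j).2.1.hw_anti (by linarith))).add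
      (hK₅ _ _ _ _ (hQ1 j) (hUs j)) (by fun_prop)
  -- Absorption: `hlo1` bounds `N` by `N / 2 + c' δ`.
  have hNle : N ≤ 2 * c' * δ := by
    have h1 := hlo1.toNNReal_le
    rw [← hN, Finset.sum_const, Finset.card_univ, Fintype.card_fin, nsmul_eq_mul] at h1
    have h2 : d * (K₅ * q) * ε ≤ 1 / 2 := by
      rw [hε, mul_inv, one_div, mul_left_comm, ← div_eq_mul_inv _ (_ + (1 : ℝ≥0))]
      exact mul_le_of_le_one_right' (div_le_one_of_le₀ le_self_add (zero_le))
    have h3 : N ≤ (1 / 2) * N + c' * δ := by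
      refine h1.trans ?_
      calc δ + K₂ * C₁ * δ +
            d * (K₃ * q * (c * δ) + K₅ * q * (ε * (N + δ) + D * (c * δ)))
          = d * (K₅ * q) * ε * N + c' * δ := by rw [hc']; ring
        _ ≤ _ := by gcongr
    have h4 : (N : ℝ) ≤ (1 / 2) * N + c' * δ := by exact_mod_cast h3
    have h5 : (N : ℝ) ≤ 2 * c' * δ := by linarith
    exact_mod_cast h5
  have hV1 : ∀ j, BW (hw (s - 1)) (V j) (N + d * δ) :=
    BW.hw_of_div_curl (fun j ↦ (hV j).1) hLN fun i j ↦ (hcurl i j).anti (by linarith)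
  -- At order `s` the product `Q·v` needs `v` only in the weight `hw (s - 1)`, now bounded, so `R'`
  -- enters once, through `Q`.
  have hhi : BW (jw s) L (δ + K₂ * C₁ * δ + ∑ _j : Fin d, K₄ * (q' * R') * (N + d * δ)) := by
    refine BW.congr ?_ hLeq.symm
    exact (hF.add hconvB (by fun_prop)).add
      (BW.sum _ (fun j _ ↦ hK₄ _ _ _ _ (hQ2 j) (hV1 j)) (by fun_prop)) (by fun_prop)
  refine (BW.hw_of_div_curl (fun j ↦ (hV j).1) hhi hcurl j).mono ?_
  rw [Finset.sum_const, Finset.card_univ, Fintype.card_fin, nsmul_eq_mul]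
  calc δ + K₂ * C₁ * δ + d * (K₄ * (q' * R') * (N + d * δ)) + d * δ
      ≤ δ + K₂ * C₁ * δ + d * (K₄ * (q' * R') * (2 * c' * δ + d * δ)) + d * δ := by gcongr
    _ = (1 + K₂ * C₁ + d) * 1 * δ + d * (K₄ * q' * (2 * c' + d)) * R' * δ := by ring
    _ ≤ (1 + K₂ * C₁ + d * (K₄ * q' * (2 * c' + d)) + d) * (1 + R') * δ := by
      rw [← NNReal.coe_le_coe]
      push_cast
      have e1 : (0 : ℝ) ≤ d * (K₄ * q' * (2 * c' + d)) * δ := by positivity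
      have e2 : (0 : ℝ) ≤ (1 + K₂ * C₁ + d) * R' * δ := by positivity
      nlinarith

/-! ### Return to Sobolev norms of functions and vector fields -/

theorem DistFT.sobolevNorm_eq_toNNReal {u : 𝓢'(E d, ℂ)} {F : E d → ℂ} {σ : ℝ} {a : ℝ≥0}
    (h : DistFT u F) (hF : BW (jw σ) F a) : sobolevNorm σ u = (wN (jw σ) F).toNNReal :=
  h.sobolevNorm_eq (hF.memLp_mul (by fun_prop))

theorem DistFT.sobolevNorm_le {u : 𝓢'(E d, ℂ)} {F : E d → ℂ} {σ : ℝ} {a : ℝ≥0}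
    (h : DistFT u F) (hF : BW (jw σ) F a) : sobolevNorm σ u ≤ a := by
  rw [h.sobolevNorm_eq_toNNReal hF]
  exact_mod_cast hF.toNNReal_le

/-- `sobolevNorm` defaults to `0` outside `H^σ`, so some finite bound must be known before the norm
can be used as one. -/
theorem DistFT.bw_sobolevNorm {u : 𝓢'(E d, ℂ)} {F : E d → ℂ} {σ : ℝ} {a : ℝ≥0}
    (h : DistFT u F) (hF : BW (jw σ) F a) : BW (jw σ) F (sobolevNorm σ u).toNNReal := by
  rw [h.sobolevNorm_eq_toNNReal hF, Real.toNNReal_coe]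
  exact hF.exact

theorem MemH.exists_isFT {σ : ℝ} {f : E d → ℝ} (hf : MemH σ f) :
    ∃ F, IsFT (fun x ↦ (f x : ℂ)) F ∧ BW (jw σ) F (normH σ f).toNNReal := by
  obtain ⟨F, hF⟩ := IsFT.exists_fourier (f := fun x ↦ (f x : ℂ)) hf.1.ofReal
  exact ⟨F, hF, hF.distFT.bw_sobolevNorm (BW.of_memLp (by fun_prop) (fun ξ ↦ (jw_pos σ ξ).ne')
    (hF.distFT.memSobolev_iff.1 hf.2))⟩

theorem IsFT.memH {σ : ℝ} {f : E d → ℝ} {F : E d → ℂ} {a : ℝ≥0}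
    (h : IsFT (fun x ↦ (f x : ℂ)) F) (hF : BW (jw σ) F a) : MemH σ f :=
  ⟨by simpa using h.memLp.re, h.distFT.memSobolev_iff.2 (hF.memLp_mul (by fun_prop))⟩

theorem VecMemH.exists_isFT {σ : ℝ} {v : E d → E d} (hv : VecMemH σ v) :
    ∃ (V : Fin d → E d → ℂ) (r : ℝ≥0), (∀ j, IsFT (fun x ↦ (v x j : ℂ)) (V j)) ∧
      ∀ j, BW (jw σ) (V j) r := by
  choose V hV hb using fun j ↦ (hv j).exists_isFT
  exact ⟨V, ∑ j, (normH σ fun x ↦ v x j).toNNReal, hV, fun j ↦ (hb j).mono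
    (Finset.single_le_sum (f := fun j ↦ (normH σ fun x ↦ v x j).toNNReal)
      (fun _ _ ↦ zero_le) (Finset.mem_univ j))⟩

section VectorFields

variable {σ : ℝ} {v : E d → E d} {V : Fin d → E d → ℂ} {r : ℝ≥0}

theorem IsFT.distFT_lineDeriv {f F : E d → ℂ} {a : ℝ≥0} (hσ : 0 ≤ σ) (hf : IsFT f F)
    (hF : BW (jw (σ + 1)) F a) (i : Fin d) : DistFT (∂_{e i} (toDist f)) (dMul i F) :=
  hf.distFT.lineDeriv i ((hF.dMul i).memLp hσ)

theorem distFT_pd (hσ : 0 ≤ σ) (hv : ∀ j, IsFT (fun x ↦ (v x j : ℂ)) (V j))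
    (hV : ∀ j, BW (jw (σ + 1)) (V j) r) (i j : Fin d) : DistFT (pd v i j) (dMul i (V j)) :=
  (hv j).distFT_lineDeriv hσ (hV j) i

theorem BW.of_normDiv (hσ : 0 ≤ σ) (hv : ∀ j, IsFT (fun x ↦ (v x j : ℂ)) (V j))
    (hV : ∀ j, BW (jw (σ + 1)) (V j) r) :
    BW (jw σ) (∑ j, WeightedFriedrichs.dMul j (V j)) (normDiv σ v).toNNReal :=
  (DistFT.sum Finset.univ fun j _ ↦ distFT_pd hσ hv hV j j).bw_sobolevNorm
    (BW.sum Finset.univ (fun j _ ↦ (hV j).dMul j) (by fun_prop))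

theorem BW.of_normCurl (hσ : 0 ≤ σ) (hv : ∀ j, IsFT (fun x ↦ (v x j : ℂ)) (V j))
    (hV : ∀ j, BW (jw (σ + 1)) (V j) r) (i j : Fin d) :
    BW (jw σ) (WeightedFriedrichs.dMul i (V j) - WeightedFriedrichs.dMul j (V i))
      (normCurl σ v).toNNReal := by
  -- `normCurl` sums over `i < j` only; the other entries follow by antisymmetry.
  have key : ∀ i j, i < j →
      BW (jw σ) (WeightedFriedrichs.dMul i (V j) - WeightedFriedrichs.dMul j (V i))
        (normCurl σ v).toNNReal := by
    intro i j hij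
    refine (((distFT_pd hσ hv hV i j).sub (distFT_pd hσ hv hV j i)).bw_sobolevNorm
      (((hV j).dMul i).sub ((hV i).dMul j) (by fun_prop))).mono (Real.toNNReal_mono ?_)
    refine Real.le_sqrt_of_sq_le ?_
    refine le_trans ?_ (Finset.single_le_sum (f := fun j ↦ ∑ i ∈ Finset.univ.filter (· < j),
      sobolevNorm σ (pd v i j - pd v j i) ^ 2) (fun _ _ ↦ by positivity) (Finset.mem_univ j))
    exact Finset.single_le_sum (f := fun i ↦ sobolevNorm σ (pd v i j - pd v j i) ^ 2)
      (fun _ _ ↦ by positivity) (by simpa using hij)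
  rcases lt_trichotomy i j with h | rfl | h
  · exact key i j h
  · rw [sub_self]
    exact (BW.zero _).mono zero_le
  · simpa using (key j i h).neg

theorem normGrad_le (hσ : 0 ≤ σ) (hv : ∀ j, IsFT (fun x ↦ (v x j : ℂ)) (V j))
    (hV : ∀ j, BW (jw (σ + 1)) (V j) r) {b : ℝ≥0} (h : ∀ i j, BW (jw σ) (dMul i (V j)) b) :
    normGrad σ v ≤ d * b := by
  refine Real.sqrt_le_iff.2 ⟨by positivity, ?_⟩
  have h1 : ∀ i j, sobolevNorm σ (pd v i j) ^ 2 ≤ (b : ℝ) ^ 2 := fun i j ↦ by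
    have h2 := distFT_pd hσ hv hV i j
    have h3 : 0 ≤ sobolevNorm σ (pd v i j) := by
      rw [h2.sobolevNorm_eq_toNNReal (h i j)]; positivity
    have := h2.sobolevNorm_le (h i j)
    gcongr
  calc ∑ i, ∑ j, sobolevNorm σ (pd v i j) ^ 2 ≤ ∑ _i : Fin d, ∑ _j : Fin d, (b : ℝ) ^ 2 :=
        Finset.sum_le_sum fun i _ ↦ Finset.sum_le_sum fun j _ ↦ h1 i j
    _ = (d * b) ^ 2 := by simp; ring

theorem normDiv_nonneg (σ : ℝ) (v : E d → E d) : 0 ≤ normDiv σ v := by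
  unfold normDiv sobolevNorm
  split_ifs <;> positivity

theorem normCurl_nonneg (σ : ℝ) (v : E d → E d) : 0 ≤ normCurl σ v := Real.sqrt_nonneg _

theorem MemH.exists_isFT_add_one {φ : E d → ℝ} (hφ : MemH (σ + 1) φ) :
    ∃ Φ, IsFT (fun x ↦ (φ x : ℂ)) Φ ∧ BW (jw σ) Φ (normH σ φ).toNNReal ∧
      BW (jw (σ + 1)) Φ (normH (σ + 1) φ).toNNReal := by
  obtain ⟨Φ, h, hb⟩ := hφ.exists_isFT
  exact ⟨Φ, h, h.distFT.bw_sobolevNorm (hb.anti (by linarith)), hb⟩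

/-- `e^φ v = v + (e^φ - 1) v`, and `H^{σ+1}` is an algebra. -/
theorem VecMemH.weighted {φ : E d → ℝ} (hσ : (d : ℝ) / 2 < σ) (hφ : MemH (σ + 1) φ)
    (hv : VecMemH (σ + 1) v) : VecMemH (σ + 1) (weighted φ v) := by
  have hd : (0 : ℝ) ≤ d := d.cast_nonneg
  obtain ⟨Φ, h, h0, h1⟩ := hφ.exists_isFT_add_one
  obtain ⟨V, r, hV, hVb⟩ := hv.exists_isFT
  obtain ⟨C, M, hE⟩ := exists_exp_sub_one hσ (normH σ φ).toNNReal
  obtain ⟨-, A, hA, -, hAb⟩ := hE φ Φ _ h h0 h1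
  obtain ⟨K, hK⟩ := (admissible_jw (d := d) (σ + 1)).exists_conv (a := σ + 1) (by linarith) le_rfl
    (by linarith)
  intro j
  have h2 := (hV j).add (hA.mul_of_BW (t := σ + 1) (by linarith) (hV j) hAb (hVb j))
  refine IsFT.memH (h2.congr (.of_forall fun x ↦ ?_) ae_eq_rfl)
    ((hVb j).add (hK _ _ _ _ hAb (hVb j)) (by fun_prop))
  simp [WeightedFriedrichs.weighted]
  ring

theorem IsFT.toDist_eq {f g F : E d → ℂ} (h : IsFT f F) (h' : IsFT g F) :
    toDist f = toDist g := by
  have h1 : 𝓕⁻ (𝓕 (toDist f)) = 𝓕⁻ (𝓕 (toDist g)) := by rw [h.fourier_toDist, h'.fourier_toDist]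
  rwa [FourierTransform.fourierInv_fourier_eq, FourierTransform.fourierInv_fourier_eq] at h1

/-- `∇φ` lies in `H^σ` with `σ > d/2`, so its transform is integrable and `∇φ` is bounded. -/
theorem gradSup_lt_top {φ : E d → ℝ} (hσ : (d : ℝ) / 2 < σ) (hφ : MemH (σ + 1) φ) :
    gradSup φ < ⊤ := by
  have hd : (0 : ℝ) ≤ d := d.cast_nonneg
  obtain ⟨Φ, h, -, h1⟩ := hφ.exists_isFT_add_one
  have hb := fun i ↦ h1.dMul i
  choose g hg using fun i ↦ IsFT.exists_fourierInv ((hb i).memLp (by linarith))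
  have hbd : ∀ i, ∃ M : ℝ, ∀ᵐ x, ‖g i x‖ ≤ M := fun i ↦
    ⟨_, (hg i).norm_le_integral ((hb i).integrable_jw hσ)⟩
  choose M hM using hbd
  have hGrad : IsGradient φ fun x ↦ WithLp.toLp 2 fun i ↦ g i x := by
    refine ⟨MemLp.of_eval_piLp fun i ↦ (hg i).memLp, fun i ↦ ?_⟩
    obtain ⟨k, hk, hk'⟩ := h.distFT_lineDeriv (by linarith) h1 i
    rw [hk']
    exact (hg i).toDist_eq hk
  refine (iInf₂_le _ hGrad).trans_lt (MemLp.of_eval_piLp fun i ↦ ?_ : MemLp _ ∞ volume).2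
  exact memLp_top_of_bound (hg i).memLp.1 (M i) (hM i)

end VectorFields

/-! ### The two estimates and their constants -/

theorem exists_normGrad_le (hd : 3 ≤ d) {s : ℝ} (hs : (d : ℝ) / 2 < s - 1 / 4) (R : ℝ≥0) :
    ∃ C : ℝ≥0, ∀ (φ : E d → ℝ) (v : E d → E d), MemH (s + 1) φ → VecMemH (s + 1) v →
      normH s φ ≤ R → normGrad s v ≤
        (1 + normH (s + 1) φ) * C * (normDiv s (weighted φ v) + normCurl s v) := by
  have hd' : (3 : ℝ) ≤ d := by exact_mod_cast hd
  have hs0 : 0 ≤ s := by linarith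
  obtain ⟨C, hC⟩ := exists_weighted_div_curl hd hs R
  refine ⟨d * C, fun φ v hφ hv hR ↦ ?_⟩
  obtain ⟨Φ, h, h0, h1⟩ := hφ.exists_isFT_add_one
  obtain ⟨V, r, hV, hVb⟩ := hv.exists_isFT
  obtain ⟨G, r', hG, hGb⟩ := (hv.weighted (by linarith) hφ).exists_isFT
  have hdiv := BW.of_normDiv hs0 hG hGb
  have hcurl := BW.of_normCurl hs0 hV hVb
  have key := hC φ Φ (fun j x ↦ v x j) V G _
    ((normDiv s (weighted φ v)).toNNReal + (normCurl s v).toNNReal) (max r r') h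
    (h0.mono (Real.toNNReal_le_iff_le_coe.2 hR)) h1 hV
    (fun j ↦ (hVb j).mono (le_max_left _ _))
    (fun j ↦ (hG j).congr (.of_forall fun x ↦ by simp [weighted]) ae_eq_rfl)
    (fun j ↦ (hGb j).mono (le_max_right _ _)) (hdiv.mono le_self_add)
    fun i j ↦ (hcurl i j).mono le_add_self
  refine (normGrad_le hs0 hV hVb fun i j ↦ (key j).dMul_of_hw i).trans_eq ?_
  have hφ0 : 0 ≤ normH (s + 1) φ := by
    rw [normH, h.distFT.sobolevNorm_eq_toNNReal h1]; positivity
  push_cast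
  rw [Real.coe_toNNReal _ hφ0, Real.coe_toNNReal _ (normDiv_nonneg _ _),
    Real.coe_toNNReal _ (normCurl_nonneg _ _)]
  ring

theorem dMul_add (i : Fin d) (F G : E d → ℂ) : dMul i (F + G) = dMul i F + dMul i G := by
  ext ξ
  simp [dMul, mul_add]

theorem dMul_congr (i : Fin d) {F G : E d → ℂ} (h : F =ᵐ[volume] G) :
    dMul i F =ᵐ[volume] dMul i G := by
  filter_upwards [h] with ξ hξ
  rw [dMul, dMul, hξ]

/-- The weighted estimate for `-φ` and `g = e^φ v` has data `div v` and `curl g`, and bounds `∇g`.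
The product rule for `v = e^{-φ} g` then gives `∇v`; placing `∇ e^{-φ}` in `H^s` costs the `H^{s+1}`
norm of `φ`. -/
theorem exists_normGrad_le' (hd : 3 ≤ d) {s : ℝ} (hs : (d : ℝ) / 2 < s - 1 / 4) (R : ℝ≥0) :
    ∃ C : ℝ≥0, ∀ (φ : E d → ℝ) (v : E d → E d), MemH (s + 1) φ → VecMemH (s + 1) v →
      normH (s + 1) φ ≤ R → normGrad s v ≤
        C * (normDiv s v + normCurl s (weighted φ v)) := by
  have hd' : (3 : ℝ) ≤ d := by exact_mod_cast hd
  have hs0 : 0 ≤ s := by linarith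
  have hs' : (d : ℝ) / 2 < s := by linarith
  obtain ⟨C, hC⟩ := exists_weighted_div_curl hd hs R
  obtain ⟨C₁, M, hE⟩ := exists_exp_sub_one (d := d) hs' R
  obtain ⟨K, hK⟩ := (admissible_jw (d := d) s).exists_conv (a := s) hs0 le_rfl hs'
  obtain ⟨K', hK'⟩ := (admissible_hw hd s).exists_conv (a := s) hs0 le_rfl hs'
  refine ⟨d * ((1 + (K' * (C₁ * R) + K * C₁)) * (C * (1 + R))), fun φ v hφ hv hR ↦ ?_⟩
  obtain ⟨Φ, h, -, h1⟩ := hφ.exists_isFT_add_one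
  replace h1 := h1.mono (Real.toNNReal_le_iff_le_coe.2 hR)
  have h0 := h1.anti (by linarith : s ≤ s + 1)
  obtain ⟨V, r, hV, hVb⟩ := hv.exists_isFT
  obtain ⟨G, r', hG, hGb⟩ := (hv.weighted (by linarith) hφ).exists_isFT
  have hdiv := BW.of_normDiv hs0 hV hVb
  have hcurl := BW.of_normCurl hs0 hG hGb
  set δ := (normDiv s v).toNNReal + (normCurl s (weighted φ v)).toNNReal with hδ
  have hcast : ∀ j x, (v x j : ℂ) = (Real.exp (-φ x) : ℂ) * (weighted φ v x j : ℂ) := by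
    intro j x
    rw [← Complex.ofReal_mul]
    simp [weighted, ← mul_assoc, ← Real.exp_add]
  have key := hC (fun x ↦ -φ x) (-Φ) (fun j x ↦ weighted φ v x j) G V R δ (max r r')
    h.neg_ofReal h0.neg h1.neg hG (fun j ↦ (hGb j).mono (le_max_right _ _))
    (fun j ↦ (hV j).congr (.of_forall fun x ↦ hcast j x) ae_eq_rfl)
    (fun j ↦ (hVb j).mono (le_max_left _ _)) (hdiv.mono le_self_add)
    fun i j ↦ (hcurl i j).mono le_add_self
  obtain ⟨-, B, hB, hBs, hBs'⟩ := hE (fun x ↦ -φ x) (-Φ) R h.neg_ofReal h0.neg h1.neg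
  have hVG : ∀ j, V j =ᵐ[volume] G j + conv B (G j) := fun j ↦ by
    refine (hV j).unique (((hG j).add (hB.mul_of_BW (t := s + 1) (by linarith) (hG j) hBs'
      (hGb j))).congr (.of_forall fun x ↦ ?_) ae_eq_rfl)
    simp only [Pi.add_apply, Pi.mul_apply, hcast j x]
    push_cast
    ring
  have hVd : ∀ i j, BW (jw s) (dMul i (V j))
      ((1 + (K' * (C₁ * R) + K * C₁)) * (C * (1 + R)) * δ) := fun i j ↦ by
    have e1 : dMul i (V j) =ᵐ[volume]
        dMul i (G j) + (conv (dMul i B) (G j) + conv B (dMul i (G j))) := by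
      refine (dMul_congr i (hVG j)).trans ?_
      rw [dMul_add]
      exact ae_eq_rfl.add (dMul_conv hs' hBs' (hGb j) i)
    have e2 := ((key j).dMul_of_hw i).add ((hK' _ _ _ _ (hBs'.dMul i)
      ((key j).hw_anti (by linarith))).add (hK _ _ _ _ hBs ((key j).dMul_of_hw i))
        (by fun_prop)) (by fun_prop)
    exact (e2.congr e1.symm).mono (le_of_eq (by ring))
  refine (normGrad_le hs0 hV hVb hVd).trans_eq ?_
  rw [hδ]
  push_cast
  rw [Real.coe_toNNReal _ (normDiv_nonneg _ _), Real.coe_toNNReal _ (normCurl_nonneg _ _)]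
  ring

theorem normGrad_eq_normDiv {σ : ℝ} (v : E 1 → E 1) : normGrad σ v = normDiv σ v := by
  have h := normDiv_nonneg σ v
  simp only [normGrad, normDiv, Finset.univ_unique, Finset.sum_singleton] at h ⊢
  exact Real.sqrt_sq h

/-- Constants are obtained for each integer radius; their partial sums form a nondecreasing
majorant. -/
theorem exists_monotone_ge (f : ℕ → ℝ≥0) :
    ∃ g : ℝ → ℝ, Monotone g ∧ ∀ a, f ⌈a⌉₊ ≤ g a := by
  refine ⟨fun a ↦ ((∑ n ∈ Finset.range (⌈a⌉₊ + 1), f n : ℝ≥0) : ℝ), fun a b hab ↦ ?_, fun a ↦ ?_⟩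
  · have := Nat.ceil_mono hab
    exact NNReal.coe_le_coe.2 (Finset.sum_le_sum_of_subset (Finset.range_mono (by omega)))
  · exact NNReal.coe_le_coe.2 (Finset.single_le_sum (f := f) (fun _ _ ↦ zero_le) (by simp))

/-- Integrality gives `s ≥ d/2 + 1/2`, which leaves room for the interpolation exponent `s - 1/4`.
-/
theorem half_lt_sub_quarter {d s : ℕ} (h : (d : ℝ) / 2 < s) : (d : ℝ) / 2 < s - 1 / 4 := by
  have h1 : (d : ℝ) < 2 * s := by linarith
  have h2 : d + 1 ≤ 2 * s := by exact_mod_cast h1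
  have h3 : (d : ℝ) + 1 ≤ 2 * s := by exact_mod_cast h2
  linarith

theorem normH_nonneg (σ : ℝ) (f : E d → ℝ) : 0 ≤ normH σ f := by
  unfold normH sobolevNorm
  split_ifs <;> positivity

end WeightedFriedrichs

end

open WeightedFriedrichs in
theorem mainTheorem6 :
    (∀ d s : ℕ, 3 ≤ d → (d : ℝ) / 2 < (s : ℝ) →
      ∃ 𝒞 : ℝ → ℝ → ℝ,
        (∀ a a' b b' : ℝ, 0 ≤ a → a ≤ a' → 0 ≤ b → b ≤ b' → 𝒞 a b ≤ 𝒞 a' b') ∧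
        ∀ (φ : E d → ℝ) (v : E d → E d), MemH ((s : ℝ) + 1) φ → VecMemH ((s : ℝ) + 1) v →
          gradSup φ < ⊤ ∧ VecMemH ((s : ℝ) + 1) (weighted φ v) ∧
          normGrad (s : ℝ) v ≤
            (1 + normH ((s : ℝ) + 1) φ) * 𝒞 (normH (s : ℝ) φ) (gradSup φ).toReal *
              (normDiv (s : ℝ) (weighted φ v) + normCurl (s : ℝ) v)) ∧
    (∀ d s : ℕ, (d = 1 ∨ 3 ≤ d) → (d : ℝ) / 2 < (s : ℝ) →
      ∃ 𝒞 : ℝ → ℝ,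
        (∀ a a' : ℝ, 0 ≤ a → a ≤ a' → 𝒞 a ≤ 𝒞 a') ∧
        ∀ (φ : E d → ℝ) (v : E d → E d), MemH ((s : ℝ) + 1) φ → VecMemH ((s : ℝ) + 1) v →
          VecMemH ((s : ℝ) + 1) (weighted φ v) ∧
          normGrad (s : ℝ) v ≤
            𝒞 (normH ((s : ℝ) + 1) φ) *
              (normDiv (s : ℝ) v + normCurl (s : ℝ) (weighted φ v))) := by
  refine ⟨fun d s hd hs ↦ ?_, fun d s hd hs ↦ ?_⟩
  · choose C hC using fun n : ℕ ↦ exists_normGrad_le hd (half_lt_sub_quarter hs) n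
    obtain ⟨g, hg, hgC⟩ := exists_monotone_ge C
    -- The constant found depends on `‖φ‖_{H^s}` alone.
    refine ⟨fun a _ ↦ g a, fun a a' _ _ _ h _ _ ↦ hg h, fun φ v hφ hv ↦
      ⟨gradSup_lt_top hs hφ, hv.weighted hs hφ, (hC _ φ v hφ hv
        (by simpa using Nat.le_ceil (normH s φ))).trans ?_⟩⟩
    have := normH_nonneg (s + 1 : ℝ) φ
    have := add_nonneg (normDiv_nonneg s (weighted φ v)) (normCurl_nonneg s v)
    gcongr
    exact hgC _
  · rcases hd with rfl | hd
    · refine ⟨fun _ ↦ 1, fun _ _ _ _ ↦ le_rfl, fun φ v hφ hv ↦ ⟨hv.weighted hs hφ, ?_⟩⟩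
      rw [normGrad_eq_normDiv, one_mul]
      exact le_add_of_nonneg_right (normCurl_nonneg _ _)
    · choose C hC using fun n : ℕ ↦ exists_normGrad_le' hd (half_lt_sub_quarter hs) n
      obtain ⟨g, hg, hgC⟩ := exists_monotone_ge C
      refine ⟨g, fun a a' _ h ↦ hg h, fun φ v hφ hv ↦ ⟨hv.weighted hs hφ, (hC _ φ v hφ hv
        (by simpa using Nat.le_ceil (normH (s + 1) φ))).trans ?_⟩⟩
      have := add_nonneg (normDiv_nonneg s v) (normCurl_nonneg s (weighted φ v))
      gcongr
      exact hgC _
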